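/- Let $A\in\mathbb R^{d\times d}$, $C\in\mathbb R^{m\times d}$ and consider the time-invariant system $\dot\xi_t=A\xi_t$, $\zeta_t=C\xi_t$, with fundamental matrix $\Phi(t,s)=e^{(t-s)A}$. Assume that the pair $(A,C)$ is observable, i.e. two initial states producing the same output for all $t\ge 0$ coincide. Let $T\ge 0$, $\bar N\ge 1$, $\ell\ge 1$, and let sampling times $t_i^l$, $i\in\{1,\dots,\bar N\}$, $l\in\{1,\dots,\ell\}$, be given with $0\le t_i^1<\dots<t_i^\ell\le T$ for every $i$ and $t_1^\ell\le\dots\le t_{\bar N}^\ell=T$. Suppose that at least one of the following holds. - **H1 (equidistant sampling).** There is $\Delta'>0$ with $t_i^l=t_i^1+(l-1)\Delta'$ for all $i,l$, such that $\Delta'(\lambda-\lambda')\ne 2k\pi \sqrt{-1}$ for all $k\in\mathbb Z$ and all distinct (complex) eigenvalues $\lambda,\lambda'$ of $A$; and $\ell\ge d$. - **H2 (periodic non-equidistant sampling).** There are $\Delta',\Delta''>0$ with $\Delta'/\Delta''\notin\mathbb Q$ and an integer $\bar d\ge d$ with $\ell\ge(\bar d+1)d$ such that, for all $i$ and all $l\in\{1,\dots,\ell\}$,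 $$t_i^l=\begin{cases}t_i^1+(l-1)\Delta', & 1\le l\le\bar d+1,\\ t_i^1+\bar d\Delta'+\Delta'', & l=\bar d+2,\\ t_i^{l-(\bar d+1)}+\bar d\Delta'+\Delta'', & \bar d+3\le l\le \ell.\end{cases}$$ - **H3 (irregular sampling).** $\ell>\mathfrak m-1+\dfrac{\tau\delta}{2\pi}$, where $\lambda_1,\dots,\lambda_q$ are the distinct complex eigenvalues of $A$, $\mathfrak m_j$ is the index of $\lambda_j$ (the least $k$ at which the chain $\ker(A-\lambda_jI)^k$ becomes stationary), $\mathfrak m=\sum_{j=1}^q\mathfrak m_j$, $\delta=\max_{1\le j,j'\le q}\operatorname{Im}(\lambda_{j'}-\lambda_j)$ and $\tau=\max_{1\le i\le\bar N}(t_i^\ell-t_i^1)$. Then for every $i\in\{1,\dots,\bar N\}$ the sample-observability matrix $$\mathcal O_i=\begin{pmatrix}C\,\Phi(t_i^1,t_i^\ell)\\ C\,\Phi(t_i^2,t_i^\ell)\\ \vdots\\ C\,\Phi(t_i^{\ell-1},t_i^\ell)\\ C\end{pmatrix}\in\mathbb R^{\ell m\times d}$$ is left invertible, i.e. there is $L\in\mathbb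 R^{d\times \ell m}$ with $L\,\mathcal O_i=I_d$. -/

import Mathlib

/-- The fundamental matrix `Φ(t, s) = exp ((t - s) A)` of the time-invariant system `ξ' = A ξ`. -/
noncomputable def ltiFundamentalMatrix {d : ℕ} (A : Matrix (Fin d) (Fin d) ℝ) (t s : ℝ) :
    Matrix (Fin d) (Fin d) ℝ :=
  NormedSpace.exp ((t - s) • A)

theorem ltiFundamentalMatrix_self {d : ℕ} (A : Matrix (Fin d) (Fin d) ℝ) (s : ℝ) :
    ltiFundamentalMatrix A s s = 1 := by
  simp [ltiFundamentalMatrix]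

/-- `t ↦ Φ(t, s) x` is a trajectory of `ξ' = A ξ`; by `ltiFundamentalMatrix_self` it starts
from `x` at time `s`. -/
theorem hasDerivAt_ltiFundamentalMatrix_mulVec {d : ℕ} (A : Matrix (Fin d) (Fin d) ℝ)
    (x : Fin d → ℝ) (t s : ℝ) :
    HasDerivAt (fun r : ℝ => (ltiFundamentalMatrix A r s).mulVec x)
      (A.mulVec ((ltiFundamentalMatrix A t s).mulVec x)) t := by
  let _ : NormedRing (Matrix (Fin d) (Fin d) ℝ) := Matrix.linftyOpNormedRing
  let _ : NormedAlgebra ℝ (Matrix (Fin d) (Fin d) ℝ) := Matrix.linftyOpNormedAlgebra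
  have h1 : HasDerivAt (fun r : ℝ => NormedSpace.exp ((r - s) • A))
      (A * NormedSpace.exp ((t - s) • A)) t := by
    have h := (hasDerivAt_exp_smul_const' (𝕂 := ℝ) A (t - s)).comp_sub_const t s
    exact h
  let L : Matrix (Fin d) (Fin d) ℝ →ₗ[ℝ] (Fin d → ℝ) :=
    { toFun := fun M => M.mulVec x
      map_add' := fun M N => Matrix.add_mulVec M N x
      map_smul' := fun c M => Matrix.smul_mulVec c M x }
  have h2 := (L.toContinuousLinearMap.hasFDerivAt
    (x := NormedSpace.exp ((t - s) • A))).comp_hasDerivAt t h1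
  rw [Matrix.mulVec_mulVec]
  exact h2

/-- The pair `(A, C)` is observable: two initial states of `ξ' = A ξ`, `ζ = C ξ` that produce the
same output at all times `t ≥ 0` coincide. -/
def IsObservablePair {d m : ℕ} (A : Matrix (Fin d) (Fin d) ℝ) (C : Matrix (Fin m) (Fin d) ℝ) :
    Prop :=
  ∀ x y : Fin d → ℝ,
    (∀ t : ℝ, 0 ≤ t → C.mulVec ((ltiFundamentalMatrix A t 0).mulVec x) =
      C.mulVec ((ltiFundamentalMatrix A t 0).mulVec y)) → x = y

/-- Sampling schedule: `t i l` is the time at which the `l`-th of the `ℓ` output samples is taken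
from the `i`-th of the `Nbar` trajectories over the horizon `[0, T]`. Both indices start at `1`, and
only the values for `i ∈ [1 : Nbar]` and `l ∈ [1 : ℓ]` matter. -/
structure IsSamplingSchedule (Nbar ℓ : ℕ) (T : ℝ) (t : ℕ → ℕ → ℝ) : Prop where
  one_le_Nbar : 1 ≤ Nbar
  one_le_ell : 1 ≤ ℓ
  nonneg : ∀ i ∈ Finset.Icc 1 Nbar, 0 ≤ t i 1
  strict_increasing : ∀ i ∈ Finset.Icc 1 Nbar, ∀ l l' : ℕ, 1 ≤ l → l < l' → l' ≤ ℓ → t i l < t i l'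
  le_horizon : ∀ i ∈ Finset.Icc 1 Nbar, t i ℓ ≤ T
  last_increasing : ∀ i i' : ℕ, 1 ≤ i → i ≤ i' → i' ≤ Nbar → t i ℓ ≤ t i' ℓ
  last_eq_horizon : t Nbar ℓ = T

/-- The sample-observability matrix with block rows `C(t^l) Φ(t^l, t^ℓ)`, `l = 1, …, ℓ`, for an
output matrix `C(·)`, a fundamental matrix `Φ(·, ·)` and sampling times `t^1, …, t^ℓ`.
The block row with zero-based number `p.1` belongs to `l = p.1 + 1`. -/
def sampleObservabilityMatrix {d m : ℕ} (C : ℝ → Matrix (Fin m) (Fin d) ℝ)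
    (Φ : ℝ → ℝ → Matrix (Fin d) (Fin d) ℝ) (ℓ : ℕ) (t : ℕ → ℝ) :
    Matrix (Fin ℓ × Fin m) (Fin d) ℝ :=
  Matrix.of fun p j => (C (t ((p.1 : ℕ) + 1)) * Φ (t ((p.1 : ℕ) + 1)) (t ℓ)) p.2 j

/-- Left invertibility of a (possibly rectangular) real matrix. -/
def IsLeftInvertibleMatrix {ρ : Type*} [Fintype ρ] {d : ℕ} (M : Matrix ρ (Fin d) ℝ) : Prop :=
  ∃ L : Matrix (Fin d) ρ ℝ, L * M = 1

/-- A real square matrix, regarded as a complex one. -/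
noncomputable def complexified {d : ℕ} (A : Matrix (Fin d) (Fin d) ℝ) :
    Matrix (Fin d) (Fin d) ℂ :=
  A.map (fun x : ℝ => (x : ℂ))

/-- The (finitely many, distinct, complex) eigenvalues of the real matrix `A`. -/
noncomputable def complexEigenvalues {d : ℕ} (A : Matrix (Fin d) (Fin d) ℝ) : Finset ℂ :=
  (complexified A).charpoly.roots.toFinset

/-- The index of an eigenvalue `μ` of `A`: the least `k` at which the chain of the kernels of
`(A - μ)^k` becomes stationary, i.e. the size of the largest Jordan block of `μ`. -/
noncomputable def eigenvalueIndex {d : ℕ} (A : Matrix (Fin d) (Fin d) ℝ) (μ : ℂ) : ℕ :=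
  Module.End.maxGenEigenspaceIndex (Matrix.toLin' (complexified A)) μ

/-- `𝔪`: the sum of the indices of the distinct eigenvalues of `A`. -/
noncomputable def sumEigenvalueIndices {d : ℕ} (A : Matrix (Fin d) (Fin d) ℝ) : ℕ :=
  ∑ μ ∈ complexEigenvalues A, eigenvalueIndex A μ

/-- `δ`: the maximum of `Im (μ' - μ)` over the eigenvalues `μ, μ'` of `A`. -/
noncomputable def spectralSpread {d : ℕ} (A : Matrix (Fin d) (Fin d) ℝ) : ℝ :=
  sSup {r : ℝ | ∃ μ ∈ complexEigenvalues A, ∃ μ' ∈ complexEigenvalues A, r = (μ' - μ).im}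

/-- `τ`: the maximum over the trajectories of the length `t_i^ℓ - t_i^1` of the observation
interval. -/
noncomputable def maxObservationLength (Nbar ℓ : ℕ) (t : ℕ → ℕ → ℝ) : ℝ :=
  sSup {r : ℝ | ∃ i ∈ Finset.Icc 1 Nbar, r = t i ℓ - t i 1}

/-- Equidistant, non-pathological sampling. -/
def EquidistantSampling {d : ℕ} (A : Matrix (Fin d) (Fin d) ℝ) (Nbar ℓ : ℕ) (t : ℕ → ℕ → ℝ) :
    Prop :=
  ∃ Δ' : ℝ, 0 < Δ' ∧
    (∀ i ∈ Finset.Icc 1 Nbar, ∀ l ∈ Finset.Icc 1 ℓ, t i l = t i 1 + ((l : ℝ) - 1) * Δ') ∧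
    (∀ μ ∈ complexEigenvalues A, ∀ μ' ∈ complexEigenvalues A, μ ≠ μ' →
      ∀ k : ℤ, (Δ' : ℂ) * (μ - μ') ≠ 2 * (k : ℂ) * (Real.pi : ℂ) * Complex.I) ∧
    d ≤ ℓ

/-- Periodic non-equidistant sampling for a state space of dimension `d`. -/
def PeriodicSampling (d Nbar ℓ : ℕ) (t : ℕ → ℕ → ℝ) : Prop :=
  ∃ (Δ' Δ'' : ℝ) (dbar : ℕ), 0 < Δ' ∧ 0 < Δ'' ∧ Irrational (Δ' / Δ'') ∧ d ≤ dbar ∧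
    (dbar + 1) * d ≤ ℓ ∧
    ∀ i ∈ Finset.Icc 1 Nbar, ∀ l ∈ Finset.Icc 1 ℓ,
      (l ≤ dbar + 1 → t i l = t i 1 + ((l : ℝ) - 1) * Δ') ∧
      (l = dbar + 2 → t i l = t i 1 + (dbar : ℝ) * Δ' + Δ'') ∧
      (dbar + 3 ≤ l → t i l = t i (l - (dbar + 1)) + (dbar : ℝ) * Δ' + Δ'')

/-- Irregular sampling: `ℓ > 𝔪 - 1 + τ δ / (2 π)`. -/
def IrregularSampling {d : ℕ} (A : Matrix (Fin d) (Fin d) ℝ) (Nbar ℓ : ℕ) (t : ℕ → ℕ → ℝ) : Prop :=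
  (ℓ : ℝ) > (sumEigenvalueIndices A : ℝ) - 1 +
    maxObservationLength Nbar ℓ t * spectralSpread A / (2 * Real.pi)

/-!
An output `f(s) = cᵀ exp(s A) z` of the system is an exponential polynomial. A vector `x` in the
kernel of the sample-observability matrix yields, with `z = exp(-t_ℓ A) x` and for every row `c` of
`C`, such an output that vanishes at the sampling times. Each sampling condition forces `f = 0`
(`realOutputSignal_eq_zero_of_samples`); observability then gives `z = 0`, and `x = 0`.

*Equidistant sampling.* By the Cayley–Hamilton theorem for `exp(Δ A)`, `d` consecutive samples
determine all samples at multiples of `Δ`. Generalised eigenspaces of `exp(Δ A)` lie in those of `A`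
because the sampling period is non-pathological, and on these the output is an exponential times a
polynomial with infinitely many zeros (`outputSignal_eq_zero_of_periodic`).

*Periodic sampling.* The sampling times contain a `d × d` block of a lattice spanned by `Δ'` and
`P = dbar Δ' + Δ''`. Two applications of the Cayley–Hamilton theorem extend the zeros to the group
generated by `Δ'` and `Δ''`, which is dense
(`outputSignal_eq_zero_of_doubly_periodic`).

*Irregular sampling.* The point is a zero bound for real exponential polynomials
(`card_zeros_outputSignal_le`). The turning of a plane curve `g` is measured by integral geometry:
integrate over all directions `θ` the number of sign changes of `Re (e^{iθ} g)`. Rolle's theorem in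
every direction shows that the turning of `g` exceeds that of `g'` by at most half a turn
(`turning_le_turning_deriv_add`), and multiplication by `e^{iωs}` increases the turning over an
interval of length `τ` by at most `|ω| τ` (`turning_rotate_le`). Let the eigenvalues `λ₁, …, λₙ`,
repeated according to their indices, be ordered by imaginary part. Removing them one by one, by
differentiating `e^{-λ s} F` for the current output `F`, costs `n - 1` half-turns and the
rotation `(Im λₙ - Im λ₁) τ` (`turning_outputSignal_le`). At the start, `e^{-λ₁ s} f` with `f` real
has the zeros of `f` in every direction and turns by `|Im λ₁| τ` besides
(`le_turning_outputSignal`). As the spectrum is symmetric under conjugation, the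
difference of the two rotations is `τ δ / 2`, and `f` has at most `n - 1 + τ δ / (2 π)` distinct
zeros. To avoid any regularity questions about the argument of a curve, turning is computed on
uniform grids, and Fatou's lemma passes to the limit.
-/

/-! ### Sign patterns along a uniform grid -/

open Filter Topology

open Classical in
/-- The number of indices `k < n` at which the truth value of `B` changes between `k` and `k + 1`. -/
noncomputable def flipCount (B : ℕ → Prop) (n : ℕ) : ℕ :=
  ((Finset.range n).filter fun k => ¬(B k ↔ B (k + 1))).card

theorem flipCount_zero (B : ℕ → Prop) : flipCount B 0 = 0 := by
  simp [flipCount]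

theorem flipCount_succ_of_iff {B : ℕ → Prop} {n : ℕ} (h : B n ↔ B (n + 1)) :
    flipCount B (n + 1) = flipCount B n := by
  simp [flipCount, Finset.range_add_one, Finset.filter_insert, h]

theorem flipCount_succ_of_not_iff {B : ℕ → Prop} {n : ℕ} (h : ¬(B n ↔ B (n + 1))) :
    flipCount B (n + 1) = flipCount B n + 1 := by
  simp [flipCount, Finset.range_add_one, Finset.filter_insert, h]

theorem flipCount_mono (B : ℕ → Prop) : Monotone (flipCount B) := by
  refine monotone_nat_of_le_succ fun n => ?_
  by_cases h : B n ↔ B (n + 1)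
  · rw [flipCount_succ_of_iff h]
  · rw [flipCount_succ_of_not_iff h]; omega

theorem flipCount_lt_of_not_iff {B : ℕ → Prop} {i j : ℕ} (hij : i ≤ j) (h : ¬(B i ↔ B j)) :
    flipCount B i + 1 ≤ flipCount B j := by
  induction j, hij using Nat.le_induction with
  | base => exact absurd Iff.rfl h
  | succ j hij ih =>
    by_cases hj : B j ↔ B (j + 1)
    · rw [flipCount_succ_of_iff hj]; exact ih (by rwa [hj])
    · rw [flipCount_succ_of_not_iff hj]
      have := flipCount_mono B hij
      omega

/-- If every change of `B` is witnessed, in order, by a place where `W` has the new truth value of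
`B`, then `W` changes at least as often as `B`, up to one. -/
theorem flipCount_le_of_witness {B W : ℕ → Prop} {κ : ℕ → ℕ} {m n : ℕ}
    (hκ : ∀ k k', k ≤ k' → k' < m → κ k ≤ κ k') (hn : ∀ k < m, κ k ≤ n)
    (h : ∀ k < m, ¬(B k ↔ B (k + 1)) → (W (κ k) ↔ B (k + 1))) :
    flipCount B m ≤ flipCount W n + 1 := by
  have key : ∀ j ≤ m, flipCount B j ≠ 0 →
      ∃ k < j, (W (κ k) ↔ B j) ∧ flipCount B j ≤ flipCount W (κ k) + 1 := by
    intro j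
    induction j with
    | zero => intro _ h0; exact absurd (flipCount_zero B) h0
    | succ j ih =>
      intro hj h0
      by_cases hB : B j ↔ B (j + 1)
      · rw [flipCount_succ_of_iff hB] at h0 ⊢
        obtain ⟨k, hk, hW, hle⟩ := ih (by omega) h0
        exact ⟨k, by omega, hW.trans hB, hle⟩
      · refine ⟨j, by omega, h j (by omega) hB, ?_⟩
        rw [flipCount_succ_of_not_iff hB]
        by_cases h0' : flipCount B j = 0
        · omega
        · obtain ⟨k, hk, hW, hle⟩ := ih (by omega) h0'
          have := flipCount_lt_of_not_iff (B := W) (hκ k j hk.le (by omega))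
            (by rw [hW, h j (by omega) hB]; exact hB)
          omega
  by_cases h0 : flipCount B m = 0
  · omega
  · obtain ⟨k, hk, -, hle⟩ := key m le_rfl h0
    have := flipCount_mono W (hn k hk)
    omega

/-- Disjoint ordered index pairs across which `W` differs each give a change of `W`. -/
theorem le_flipCount_of_pairs {W : ℕ → Prop} {κ κ' : ℕ → ℕ} {r n : ℕ}
    (h1 : ∀ i < r, κ i ≤ κ' i) (h2 : ∀ i, i + 1 < r → κ' i ≤ κ (i + 1)) (hn : ∀ i < r, κ' i ≤ n)
    (h : ∀ i < r, ¬(W (κ i) ↔ W (κ' i))) : r ≤ flipCount W n := by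
  have key : ∀ i < r, i + 1 ≤ flipCount W (κ' i) := by
    intro i
    induction i with
    | zero =>
      intro hi
      have := flipCount_lt_of_not_iff (h1 0 hi) (h 0 hi)
      omega
    | succ i ih =>
      intro hi
      have := flipCount_lt_of_not_iff (h1 _ hi) (h _ hi)
      have := flipCount_mono W (h2 i hi)
      have := ih (by omega)
      omega
  rcases r with _ | r
  · omega
  · exact (key r (by omega)).trans (flipCount_mono W (hn r (by omega)))

/-- The `k`-th point of the uniform grid with `n` steps on `[α, α + τ]`. -/
noncomputable def gridPoint (α τ : ℝ) (n k : ℕ) : ℝ := α + τ * k / n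

/-- The index of the last point of the uniform grid that does not exceed `ξ`; it is `0` if
`τ = 0`. -/
noncomputable def gridIndex (α τ : ℝ) (n : ℕ) (ξ : ℝ) : ℕ := ⌊n * (ξ - α) / τ⌋₊

theorem gridPoint_mono {α τ : ℝ} (hτ : 0 ≤ τ) (n : ℕ) : Monotone (gridPoint α τ n) := by
  intro k k' h
  unfold gridPoint
  gcongr

theorem gridPoint_mem_Icc {α τ : ℝ} (hτ : 0 ≤ τ) {n k : ℕ} (hk : k ≤ n) :
    gridPoint α τ n k ∈ Set.Icc α (α + τ) := by
  unfold gridPoint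
  have h1 : (k : ℝ) / n ≤ 1 := div_le_one_of_le₀ (by exact_mod_cast hk) (by positivity)
  have h0 : 0 ≤ (k : ℝ) / n := by positivity
  rw [mul_div_assoc]
  constructor <;> nlinarith

theorem gridIndex_mono {α τ : ℝ} (hτ : 0 ≤ τ) (n : ℕ) : Monotone (gridIndex α τ n) := by
  intro ξ ξ' h
  unfold gridIndex
  gcongr

theorem gridIndex_le {α τ ξ : ℝ} (hτ : 0 ≤ τ) (hξ : ξ ≤ α + τ) (n : ℕ) :
    gridIndex α τ n ξ ≤ n := by
  unfold gridIndex
  apply Nat.floor_le_of_le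
  apply div_le_of_le_mul₀ hτ (by positivity)
  gcongr
  linarith

theorem tendsto_gridPoint_gridIndex {α τ ξ : ℝ} (hξ : ξ ∈ Set.Icc α (α + τ)) :
    Tendsto (fun n => gridPoint α τ n (gridIndex α τ n ξ)) atTop (𝓝 ξ) := by
  have hτ : 0 ≤ τ := by linarith [hξ.1, hξ.2]
  rcases hτ.eq_or_lt with rfl | hτ'
  · have : ξ = α := by linarith [hξ.1, hξ.2]
    simp [gridPoint, this]
  · have h1 : Tendsto (fun n : ℕ => ξ - τ / n) atTop (𝓝 ξ) := by
      simpa using tendsto_const_nhds.sub (tendsto_const_div_atTop_nhds_zero_nat τ)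
    refine tendsto_of_tendsto_of_tendsto_of_le_of_le' h1 tendsto_const_nhds ?_ ?_
    · filter_upwards [eventually_gt_atTop 0] with n hn
      have hn' : (0 : ℝ) < n := by exact_mod_cast hn
      have h := Nat.sub_one_lt_floor ((n : ℝ) * (ξ - α) / τ)
      have h2 : τ / n * (n * (ξ - α) / τ - 1) ≤ τ / n * (gridIndex α τ n ξ) :=
        mul_le_mul_of_nonneg_left h.le (by positivity)
      have h3 : τ / n * (n * (ξ - α) / τ - 1) = ξ - α - τ / n := by field_simp
      unfold gridPoint
      rw [h3] at h2
      have h4 : τ / n * (gridIndex α τ n ξ : ℝ) = τ * gridIndex α τ n ξ / n := by ring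
      linarith
    · filter_upwards [eventually_gt_atTop 0] with n hn
      have hn' : (0 : ℝ) < n := by exact_mod_cast hn
      have h : (gridIndex α τ n ξ : ℝ) ≤ (n : ℝ) * (ξ - α) / τ :=
        Nat.floor_le (div_nonneg (mul_nonneg hn'.le (by linarith [hξ.1])) hτ)
      have h2 : τ / n * (gridIndex α τ n ξ) ≤ τ / n * (n * (ξ - α) / τ) :=
        mul_le_mul_of_nonneg_left h (by positivity)
      have h3 : τ / n * (n * (ξ - α) / τ) = ξ - α := by field_simp
      unfold gridPoint
      rw [h3] at h2
      have h4 : τ / n * (gridIndex α τ n ξ : ℝ) = τ * gridIndex α τ n ξ / n := by ring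
      linarith

theorem eventually_pos_gridPoint_iff {α τ ξ : ℝ} {w : ℝ → ℝ} (hw : Continuous w)
    (hξ : ξ ∈ Set.Icc α (α + τ)) (h0 : w ξ ≠ 0) :
    ∀ᶠ n in atTop, 0 < w (gridPoint α τ n (gridIndex α τ n ξ)) ↔ 0 < w ξ := by
  have h := (hw.tendsto ξ).comp (tendsto_gridPoint_gridIndex hξ)
  rcases h0.lt_or_gt with h1 | h1
  · filter_upwards [h.eventually (gt_mem_nhds h1)] with n hn
    exact ⟨fun h' => absurd h' hn.not_gt, fun h' => absurd h' h1.not_gt⟩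
  · filter_upwards [h.eventually (lt_mem_nhds h1)] with n hn
    exact ⟨fun _ => h1, fun _ => hn⟩

/-- A discretised form of Rolle's theorem: the derivative changes sign, on every sufficiently fine
grid, at least as often as the function does on a given grid, up to one. -/
theorem eventually_flipCount_le_flipCount_deriv {α τ : ℝ} (hτ : 0 ≤ τ) {v v' : ℝ → ℝ}
    (hv : ∀ s, HasDerivAt v (v' s) s) (hv' : Continuous v') (m : ℕ) :
    ∀ᶠ n in atTop, flipCount (fun k => 0 < v (gridPoint α τ m k)) m ≤
      flipCount (fun k => 0 < v' (gridPoint α τ n k)) n + 1 := by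
  have hex : ∀ k, ∃ ξ ∈ Set.Icc (gridPoint α τ m k) (gridPoint α τ m (k + 1)),
      ¬(0 < v (gridPoint α τ m k) ↔ 0 < v (gridPoint α τ m (k + 1))) →
        v' ξ ≠ 0 ∧ (0 < v' ξ ↔ 0 < v (gridPoint α τ m (k + 1))) := by
    intro k
    have hle : gridPoint α τ m k ≤ gridPoint α τ m (k + 1) := gridPoint_mono hτ m (Nat.le_succ k)
    by_cases hB : 0 < v (gridPoint α τ m k) ↔ 0 < v (gridPoint α τ m (k + 1))
    · exact ⟨_, Set.left_mem_Icc.2 hle, fun h => absurd hB h⟩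
    · have hlt : gridPoint α τ m k < gridPoint α τ m (k + 1) := by
        refine hle.lt_of_ne fun h => hB ?_
        rw [h]
      obtain ⟨ξ, hξ, hs⟩ := exists_hasDerivAt_eq_slope v v' hlt
        (fun s _ => (hv s).continuousAt.continuousWithinAt) (fun s _ => hv s)
      refine ⟨ξ, Set.Ioo_subset_Icc_self hξ, fun _ => ?_⟩
      have hpos : 0 < gridPoint α τ m (k + 1) - gridPoint α τ m k := sub_pos.2 hlt
      rw [hs]
      by_cases h1 : 0 < v (gridPoint α τ m (k + 1))
      · have h2 : v (gridPoint α τ m k) ≤ 0 := by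
          by_contra h; exact hB ⟨fun _ => h1, fun _ => not_le.1 h⟩
        have : 0 < (v (gridPoint α τ m (k + 1)) - v (gridPoint α τ m k)) /
          (gridPoint α τ m (k + 1) - gridPoint α τ m k) := div_pos (by linarith) hpos
        exact ⟨this.ne', fun _ => h1, fun _ => this⟩
      · have h2 : 0 < v (gridPoint α τ m k) := by
          by_contra h; exact hB ⟨fun h' => absurd h' h, fun h' => absurd h' h1⟩
        have : (v (gridPoint α τ m (k + 1)) - v (gridPoint α τ m k)) /
          (gridPoint α τ m (k + 1) - gridPoint α τ m k) < 0 :=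
          div_neg_of_neg_of_pos (by linarith) hpos
        exact ⟨this.ne, fun h => absurd h this.not_gt, fun h => absurd h h1⟩
  choose ξ hξ hξ' using hex
  have hmem : ∀ k < m, ξ k ∈ Set.Icc α (α + τ) := fun k hk =>
    ⟨(gridPoint_mem_Icc hτ hk.le).1.trans (hξ k).1, (hξ k).2.trans (gridPoint_mem_Icc hτ hk).2⟩
  have hmono : Monotone ξ := monotone_nat_of_le_succ fun k => (hξ k).2.trans (hξ (k + 1)).1
  have hev : ∀ᶠ n in atTop, ∀ k ∈ Finset.range m,
      ¬(0 < v (gridPoint α τ m k) ↔ 0 < v (gridPoint α τ m (k + 1))) →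
      (0 < v' (gridPoint α τ n (gridIndex α τ n (ξ k))) ↔ 0 < v' (ξ k)) := by
    rw [Filter.eventually_all_finset]
    intro k hk
    by_cases hB : 0 < v (gridPoint α τ m k) ↔ 0 < v (gridPoint α τ m (k + 1))
    · exact Eventually.of_forall fun n h => absurd hB h
    · filter_upwards [eventually_pos_gridPoint_iff hv' (hmem k (Finset.mem_range.1 hk))
        (hξ' k hB).1] with n hn _
      exact hn
  filter_upwards [hev] with n hn
  refine flipCount_le_of_witness (κ := fun k => gridIndex α τ n (ξ k))
    (fun k k' hk _ => gridIndex_mono hτ n (hmono hk))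
    (fun k hk => gridIndex_le hτ (hmem k hk).2 n) (fun k hk hB => ?_)
  exact (hn k (Finset.mem_range.2 hk) hB).trans (hξ' k hB).2

/-- Between two consecutive zeros of a function that vanishes on no interval its derivative takes
both signs, so zeros, counted without multiplicity, give sign changes of the derivative. -/
theorem eventually_card_zeros_le_flipCount_deriv {α τ : ℝ} (hτ : 0 ≤ τ) {v v' : ℝ → ℝ}
    (hv : ∀ s, HasDerivAt v (v' s) s) (hv' : Continuous v')
    (hne : ∀ a b, a < b → ∃ y ∈ Set.Ioo a b, v y ≠ 0) (Z : Finset ℝ)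
    (hZ : ∀ x ∈ Z, x ∈ Set.Icc α (α + τ) ∧ v x = 0) :
    ∀ᶠ n in atTop, Z.card ≤ flipCount (fun k => 0 < v' (gridPoint α τ n k)) n + 1 := by
  obtain ⟨r, hr⟩ : ∃ r, Z.card = r + 1 ∨ Z.card = 0 := by
    rcases Z.card with _ | r
    · exact ⟨0, Or.inr rfl⟩
    · exact ⟨r, Or.inl rfl⟩
  rcases hr with hr | hr
  swap
  · exact Eventually.of_forall fun n => by omega
  let x : ℕ → ℝ := fun i => if h : i < r + 1 then Z.orderEmbOfFin hr ⟨i, h⟩ else 0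
  have hx : ∀ i ≤ r, x i ∈ Z := by
    intro i hi
    simp only [x, dif_pos (Nat.lt_succ_of_le hi)]
    exact Finset.orderEmbOfFin_mem _ _ _
  have hxlt : ∀ i < r, x i < x (i + 1) := by
    intro i hi
    simp only [x, dif_pos (show i < r + 1 by omega), dif_pos (show i + 1 < r + 1 by omega)]
    exact (Z.orderEmbOfFin hr).strictMono (by simp [Fin.lt_def])
  have hex : ∀ i, ∃ p q, i < r → x i < p ∧ p < q ∧ q < x (i + 1) ∧ v' p ≠ 0 ∧ v' q ≠ 0 ∧
      ¬(0 < v' p ↔ 0 < v' q) := by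
    intro i
    by_cases hi : i < r
    swap
    · exact ⟨0, 0, fun h => absurd h hi⟩
    obtain ⟨y, hy, hy0⟩ := hne _ _ (hxlt i hi)
    obtain ⟨p, hp, hps⟩ := exists_hasDerivAt_eq_slope v v' hy.1
      (fun s _ => (hv s).continuousAt.continuousWithinAt) (fun s _ => hv s)
    obtain ⟨q, hq, hqs⟩ := exists_hasDerivAt_eq_slope v v' hy.2
      (fun s _ => (hv s).continuousAt.continuousWithinAt) (fun s _ => hv s)
    rw [(hZ _ (hx i hi.le)).2, sub_zero] at hps
    rw [(hZ _ (hx (i + 1) hi)).2, zero_sub] at hqs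
    have hp1 : 0 < y - x i := sub_pos.2 hy.1
    have hq1 : 0 < x (i + 1) - y := sub_pos.2 hy.2
    refine ⟨p, q, fun _ => ⟨hp.1, hp.2.trans hq.1, hq.2, ?_, ?_, ?_⟩⟩
    · rw [hps]; exact div_ne_zero hy0 hp1.ne'
    · rw [hqs]; exact div_ne_zero (neg_ne_zero.2 hy0) hq1.ne'
    · rw [hps, hqs, div_pos_iff_of_pos_right hp1, div_pos_iff_of_pos_right hq1]
      intro h
      rcases hy0.lt_or_gt with h1 | h1
      · linarith [h.2 (by linarith)]
      · linarith [h.1 h1]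
  choose p q hpq using hex
  have hmemp : ∀ i < r, p i ∈ Set.Icc α (α + τ) ∧ q i ∈ Set.Icc α (α + τ) := by
    intro i hi
    obtain ⟨h1, h2, h3, -⟩ := hpq i hi
    have h4 := (hZ _ (hx i hi.le)).1.1
    have h5 := (hZ _ (hx (i + 1) hi)).1.2
    exact ⟨⟨by linarith, by linarith⟩, ⟨by linarith, by linarith⟩⟩
  have hev : ∀ᶠ n in atTop, ∀ i ∈ Finset.range r,
      (0 < v' (gridPoint α τ n (gridIndex α τ n (p i))) ↔ 0 < v' (p i)) ∧
      (0 < v' (gridPoint α τ n (gridIndex α τ n (q i))) ↔ 0 < v' (q i)) := by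
    rw [Filter.eventually_all_finset]
    intro i hi
    have hi' := Finset.mem_range.1 hi
    exact (eventually_pos_gridPoint_iff hv' (hmemp i hi').1 (hpq i hi').2.2.2.1).and
      (eventually_pos_gridPoint_iff hv' (hmemp i hi').2 (hpq i hi').2.2.2.2.1)
  filter_upwards [hev] with n hn
  rw [hr]
  refine Nat.succ_le_succ (le_flipCount_of_pairs (κ := fun i => gridIndex α τ n (p i))
    (κ' := fun i => gridIndex α τ n (q i)) (fun i hi => ?_) (fun i hi => ?_) (fun i hi => ?_)
    fun i hi => ?_)
  · exact gridIndex_mono hτ n (hpq i hi).2.1.le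
  · exact gridIndex_mono hτ n ((hpq i (by omega)).2.2.1.trans (hpq (i + 1) hi).1).le
  · exact gridIndex_le hτ (hmemp i hi).2.2 n
  · rw [(hn i (Finset.mem_range.2 hi)).1, (hn i (Finset.mem_range.2 hi)).2]
    exact (hpq i hi).2.2.2.2.2

/-! ### Total turning of a plane curve -/

open Filter Topology MeasureTheory
open scoped ENNReal

instance fact_zero_lt_two_pi : Fact (0 < 2 * Real.pi) := ⟨Real.two_pi_pos⟩

/-- The point `z` lies, after rotation by the angle `θ`, in the open right half-plane. -/
def InHalfPlane (θ : AddCircle (2 * Real.pi)) (z : ℂ) : Prop :=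
  0 < ((AddCircle.toCircle θ : ℂ) * z).re

/-- The measure of the set of directions `θ` whose half-plane separates `z` from `w`: twice the
angle between `z` and `w`, if both are nonzero. -/
noncomputable def separation (z w : ℂ) : ℝ≥0∞ :=
  volume {θ : AddCircle (2 * Real.pi) | ¬(InHalfPlane θ z ↔ InHalfPlane θ w)}

theorem toCircle_coe_two_pi (x : ℝ) :
    AddCircle.toCircle (x : AddCircle (2 * Real.pi)) = Circle.exp x := by
  rw [AddCircle.toCircle_apply_mk, div_self Real.two_pi_pos.ne', one_mul]

theorem measurableSet_inHalfPlane (z : ℂ) : MeasurableSet {θ | InHalfPlane θ z} := by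
  refine (isOpen_lt continuous_const ?_).measurableSet
  exact Complex.continuous_re.comp
    ((continuous_subtype_val.comp AddCircle.continuous_toCircle).mul continuous_const)

theorem measurableSet_separating (z w : ℂ) :
    MeasurableSet {θ | ¬(InHalfPlane θ z ↔ InHalfPlane θ w)} :=
  ((measurableSet_inHalfPlane z).iff (measurableSet_inHalfPlane w)).compl

theorem separation_self (z : ℂ) : separation z z = 0 := by
  simp [separation]

theorem separation_comm (z w : ℂ) : separation z w = separation w z := by
  simp only [separation, iff_comm]

theorem separation_triangle (x y z : ℂ) : separation x z ≤ separation x y + separation y z := by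
  refine (measure_mono ?_).trans (measure_union_le _ _)
  intro θ h
  simp only [Set.mem_union, Set.mem_ofPred_eq] at h ⊢
  tauto

theorem inHalfPlane_pos_mul {r : ℝ} (hr : 0 < r) (θ : AddCircle (2 * Real.pi)) (z : ℂ) :
    InHalfPlane θ (r * z) ↔ InHalfPlane θ z := by
  unfold InHalfPlane
  rw [mul_left_comm, Complex.re_ofReal_mul, mul_pos_iff_of_pos_left hr]

theorem inHalfPlane_circleExp_mul (φ : ℝ) (θ : AddCircle (2 * Real.pi)) (z : ℂ) :
    InHalfPlane θ (Circle.exp φ * z) ↔ InHalfPlane (θ + φ) z := by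
  unfold InHalfPlane
  rw [AddCircle.toCircle_add, toCircle_coe_two_pi, Circle.coe_mul, mul_assoc]

theorem separation_circleExp_mul (φ : ℝ) (z w : ℂ) :
    separation (Circle.exp φ * z) (Circle.exp φ * w) = separation z w := by
  unfold separation
  simp only [inHalfPlane_circleExp_mul]
  exact measure_preimage_add_right volume (φ : AddCircle (2 * Real.pi))
    {θ | ¬(InHalfPlane θ z ↔ InHalfPlane θ w)}

theorem inHalfPlane_coe_circleExp (x α : ℝ) :
    InHalfPlane (x : AddCircle (2 * Real.pi)) (Circle.exp α) ↔ 0 < Real.cos (x + α) := by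
  unfold InHalfPlane
  rw [toCircle_coe_two_pi, ← Circle.coe_mul, ← Circle.exp_add, Circle.coe_exp,
    Complex.exp_ofReal_mul_I_re]

theorem separation_one_circleExp {α : ℝ} (h0 : 0 ≤ α) (h1 : α ≤ Real.pi / 2) :
    separation 1 (Circle.exp α) = ENNReal.ofReal (2 * α) := by
  have hpi := Real.pi_pos
  have hm := AddCircle.add_projection_respects_measure (T := 2 * Real.pi) (-Real.pi)
    (measurableSet_separating 1 (Circle.exp α))
  have hset : ((QuotientAddGroup.mk : ℝ → AddCircle (2 * Real.pi)) ⁻¹'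
      {θ | ¬(InHalfPlane θ 1 ↔ InHalfPlane θ (Circle.exp α))}) ∩
        Set.Ioc (-Real.pi) (-Real.pi + 2 * Real.pi) =
      Set.Ioc (-(Real.pi / 2) - α) (-(Real.pi / 2)) ∪
        Set.Ico (Real.pi / 2 - α) (Real.pi / 2) := by
    ext x
    have e1 : InHalfPlane (x : AddCircle (2 * Real.pi)) 1 ↔ 0 < Real.cos x := by
      simpa using inHalfPlane_coe_circleExp x 0
    have e2 := inHalfPlane_coe_circleExp x α
    simp only [Set.mem_inter_iff, Set.mem_preimage, Set.mem_ofPred_eq, Set.mem_union, Set.mem_Ioc,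
      Set.mem_Ico]
    change (¬(InHalfPlane (x : AddCircle (2 * Real.pi)) 1 ↔
      InHalfPlane (x : AddCircle (2 * Real.pi)) (Circle.exp α))) ∧ _ ↔ _
    rw [e1, e2]
    have pos : ∀ y, -(Real.pi / 2) < y → y < Real.pi / 2 → 0 < Real.cos y := fun y h h' =>
      Real.cos_pos_of_mem_Ioo ⟨h, h'⟩
    have npos : ∀ y, Real.pi / 2 ≤ y → y ≤ Real.pi + Real.pi / 2 → ¬0 < Real.cos y :=
      fun y h h' => (Real.cos_nonpos_of_pi_div_two_le_of_le h h').not_gt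
    have npos' : ∀ y, y ≤ -(Real.pi / 2) → -(Real.pi + Real.pi / 2) ≤ y → ¬0 < Real.cos y := by
      intro y h h'
      rw [← Real.cos_neg]
      exact npos _ (by linarith) (by linarith)
    constructor
    · rintro ⟨h, h2, h3⟩
      by_contra hcon
      push Not at hcon
      apply h
      rcases le_or_gt x (-(Real.pi / 2)) with c1 | c1
      · have c2 : x ≤ -(Real.pi / 2) - α := by
          by_contra c; linarith [hcon.1 (not_le.1 c)]
        exact iff_of_false (npos' _ c1 (by linarith)) (npos' _ (by linarith) (by linarith))
      · rcases lt_or_ge x (Real.pi / 2) with c2 | c2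
        · have c3 : x < Real.pi / 2 - α := by
            by_contra c; linarith [hcon.2 (not_lt.1 c)]
          exact iff_of_true (pos _ c1 c2) (pos _ (by linarith) (by linarith))
        · exact iff_of_false (npos _ c2 (by linarith)) (npos _ (by linarith) (by linarith))
    · rintro (⟨h2, h3⟩ | ⟨h2, h3⟩)
      · refine ⟨fun h => ?_, by linarith, by linarith⟩
        exact npos' _ h3 (by linarith) (h.2 (pos _ (by linarith) (by linarith)))
      · refine ⟨fun h => ?_, by linarith, by linarith⟩
        exact npos _ (by linarith) (by linarith) (h.1 (pos _ (by linarith) (by linarith)))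
  have hdisj : Disjoint (Set.Ioc (-(Real.pi / 2) - α) (-(Real.pi / 2)))
      (Set.Ico (Real.pi / 2 - α) (Real.pi / 2)) := by
    rw [Set.disjoint_left]
    rintro x ⟨-, h2⟩ ⟨h3, -⟩
    linarith
  unfold separation
  rw [hm, hset, measure_union hdisj measurableSet_Ico, Real.volume_Ioc, Real.volume_Ico,
    ← ENNReal.ofReal_add (by linarith) (by linarith)]
  congr 1
  ring

theorem separation_self_circleExp_mul_le (z : ℂ) {α : ℝ} (h : |α| ≤ Real.pi / 2) :
    separation z (Circle.exp α * z) ≤ ENNReal.ofReal (2 * |α|) := by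
  have hpos : ∀ (z : ℂ) (α : ℝ), 0 ≤ α → α ≤ Real.pi / 2 →
      separation z (Circle.exp α * z) ≤ ENNReal.ofReal (2 * α) := by
    intro z α h0 h1
    by_cases hz : z = 0
    · simp [hz, separation_self]
    have hz' : z = (‖z‖ : ℂ) * Circle.exp z.arg := by
      rw [Circle.coe_exp]; exact (Complex.norm_mul_exp_arg_mul_I z).symm
    have e : (Circle.exp α : ℂ) * z = (‖z‖ : ℂ) * (Circle.exp z.arg * Circle.exp α) := by
      conv_lhs => rw [hz']
      ring
    have hr : 0 < ‖z‖ := norm_pos_iff.2 hz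
    have e2 : separation z (Circle.exp α * z) = separation 1 (Circle.exp α) := by
      rw [← separation_circleExp_mul z.arg 1 (Circle.exp α), mul_one, e]
      rw [show separation z = separation ((‖z‖ : ℂ) * Circle.exp z.arg) by rw [← hz']]
      simp only [separation, inHalfPlane_pos_mul hr]
    rw [e2, separation_one_circleExp h0 h1]
  rcases le_total 0 α with h0 | h0
  · rw [abs_of_nonneg h0] at h ⊢
    exact hpos z α h0 h
  · rw [abs_of_nonpos h0] at h ⊢
    have h2 := hpos (Circle.exp α * z) (-α) (by linarith) h
    rwa [separation_comm, ← mul_assoc, ← Circle.coe_mul, ← Circle.exp_add, neg_add_cancel,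
      Circle.exp_zero, Circle.coe_one, one_mul] at h2

theorem ae_re_toCircle_mul_ne_zero {z : ℂ} (hz : z ≠ 0) :
    ∀ᵐ θ : AddCircle (2 * Real.pi), ((AddCircle.toCircle θ : ℂ) * z).re ≠ 0 := by
  have hsub : {θ : AddCircle (2 * Real.pi) | ¬((AddCircle.toCircle θ : ℂ) * z).re ≠ 0} ⊆
      Set.range fun k : ℤ => (((2 * k + 1) * Real.pi / 2 - z.arg : ℝ) : AddCircle (2 * Real.pi)) := by
    intro θ
    induction θ using QuotientAddGroup.induction_on with
    | H x =>
      intro h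
      simp only [Set.mem_ofPred_eq, not_not] at h
      change ((AddCircle.toCircle (x : AddCircle (2 * Real.pi)) : ℂ) * z).re = 0 at h
      have hz' : z = (‖z‖ : ℂ) * Circle.exp z.arg := by
        rw [Circle.coe_exp]; exact (Complex.norm_mul_exp_arg_mul_I z).symm
      rw [hz', mul_left_comm, Complex.re_ofReal_mul, toCircle_coe_two_pi, ← Circle.coe_mul,
        ← Circle.exp_add, Circle.coe_exp, Complex.exp_ofReal_mul_I_re] at h
      obtain ⟨k, hk⟩ := Real.cos_eq_zero_iff.1
        ((mul_eq_zero.1 h).resolve_left (norm_ne_zero_iff.2 hz))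
      refine ⟨k, ?_⟩
      change (((2 * k + 1) * Real.pi / 2 - z.arg : ℝ) : AddCircle (2 * Real.pi)) = (x : AddCircle _)
      rw [← hk, add_sub_cancel_right]
  refine measure_mono_null hsub ((measure_null_iff_singleton (Set.countable_range _)).2 ?_)
  intro x _
  rw [← Metric.closedBall_zero, AddCircle.volume_closedBall, mul_zero,
    min_eq_right Real.two_pi_pos.le, ENNReal.ofReal_zero]

/-- The turning of the curve `g` along the uniform grid with `n` steps on `[α, α + τ]`: the integral
over all directions `θ` of the number of steps in which the sampled curve enters or leaves the
half-plane of `θ`. -/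
noncomputable def gridTurning (α τ : ℝ) (g : ℝ → ℂ) (n : ℕ) : ℝ≥0∞ :=
  ∑ k ∈ Finset.range n, separation (g (gridPoint α τ n k)) (g (gridPoint α τ n (k + 1)))

/-- The limit inferior of the turnings of `g` along uniform grids on `[α, α + τ]`. -/
noncomputable def turning (α τ : ℝ) (g : ℝ → ℂ) : ℝ≥0∞ :=
  liminf (gridTurning α τ g) atTop

theorem flipCount_inHalfPlane_eq_sum (g : ℕ → ℂ) (n : ℕ) (θ : AddCircle (2 * Real.pi)) :
    (flipCount (fun k => InHalfPlane θ (g k)) n : ℝ≥0∞) = ∑ k ∈ Finset.range n,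
      Set.indicator {θ | ¬(InHalfPlane θ (g k) ↔ InHalfPlane θ (g (k + 1)))} 1 θ := by
  classical
  simp [flipCount, Finset.card_filter, Set.indicator_apply]

theorem measurable_flipCount_inHalfPlane (g : ℕ → ℂ) (n : ℕ) :
    Measurable fun θ => (flipCount (fun k => InHalfPlane θ (g k)) n : ℝ≥0∞) := by
  simp only [flipCount_inHalfPlane_eq_sum]
  exact Finset.measurable_fun_sum _ fun k _ => measurable_one.indicator (measurableSet_separating _ _)

theorem lintegral_flipCount_inHalfPlane (α τ : ℝ) (g : ℝ → ℂ) (n : ℕ) :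
    ∫⁻ θ, (flipCount (fun k => InHalfPlane θ (g (gridPoint α τ n k))) n : ℝ≥0∞) =
      gridTurning α τ g n := by
  simp only [flipCount_inHalfPlane_eq_sum (fun k => g (gridPoint α τ n k))]
  rw [lintegral_finsetSum _
    fun k _ => measurable_one.indicator (measurableSet_separating _ _)]
  refine Finset.sum_congr rfl fun k _ => ?_
  rw [lintegral_indicator_one (measurableSet_separating _ _)]
  rfl

/-- Fatou's lemma: if the number `X θ` of side changes is reached, up to one, along fine grids for
almost every `θ`, then its integral is at most the turning plus the length `2 π` of the circle. -/
theorem lintegral_le_turning_add {α τ : ℝ} {g : ℝ → ℂ} {X : AddCircle (2 * Real.pi) → ℕ}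
    (h : ∀ᵐ θ, ∀ᶠ n in atTop,
      X θ ≤ flipCount (fun k => InHalfPlane θ (g (gridPoint α τ n k))) n + 1) :
    ∫⁻ θ, (X θ : ℝ≥0∞) ≤ turning α τ g + ENNReal.ofReal (2 * Real.pi) := by
  have h1 : ∫⁻ θ, (X θ : ℝ≥0∞) ≤ ∫⁻ θ, liminf (fun n =>
      (flipCount (fun k => InHalfPlane θ (g (gridPoint α τ n k))) n : ℝ≥0∞) + 1) atTop := by
    refine lintegral_mono_ae ?_
    filter_upwards [h] with θ hθ
    refine le_liminf_of_le (by isBoundedDefault) ?_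
    filter_upwards [hθ] with n hn
    exact_mod_cast hn
  refine h1.trans ((lintegral_liminf_le fun n =>
    (measurable_flipCount_inHalfPlane (fun k => g (gridPoint α τ n k)) n).add_const 1).trans ?_)
  have h2 : ∀ n, ∫⁻ θ, ((flipCount (fun k => InHalfPlane θ (g (gridPoint α τ n k))) n : ℝ≥0∞) + 1) =
      gridTurning α τ g n + ENNReal.ofReal (2 * Real.pi) := by
    intro n
    rw [lintegral_add_right _ measurable_const, lintegral_flipCount_inHalfPlane, lintegral_one,
      AddCircle.measure_univ]
  simp only [h2]
  exact (liminf_add_const atTop _ _ (by isBoundedDefault) (by isBoundedDefault)).le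

/-- Rolle's theorem for plane curves: apply the real theorem to the component of the curve in each
direction and integrate. -/
theorem turning_le_turning_deriv_add {α τ : ℝ} (hτ : 0 ≤ τ) {u u' : ℝ → ℂ}
    (hu : ∀ s, HasDerivAt u (u' s) s) (hu' : Continuous u') :
    turning α τ u ≤ turning α τ u' + ENNReal.ofReal (2 * Real.pi) := by
  refine liminf_le_of_frequently_le' (Frequently.of_forall fun m => ?_)
  rw [← lintegral_flipCount_inHalfPlane]
  refine lintegral_le_turning_add (ae_of_all _ fun θ => ?_)
  exact eventually_flipCount_le_flipCount_deriv hτ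
    (fun s => (Complex.reCLM.hasFDerivAt.comp_hasDerivAt s ((hu s).const_mul _)))
    (Complex.continuous_re.comp (continuous_const.mul hu')) m

theorem turning_const (α τ : ℝ) (c : ℂ) : turning α τ (fun _ => c) = 0 := by
  have : gridTurning α τ (fun _ => c) = fun _ => 0 := by
    funext n; simp [gridTurning, separation_self]
  rw [turning, this, liminf_const]

theorem gridPoint_succ (α τ : ℝ) (n k : ℕ) :
    gridPoint α τ n (k + 1) = gridPoint α τ n k + τ / n := by
  unfold gridPoint; push_cast; ring

theorem eventually_abs_mul_div_le (ω τ : ℝ) : ∀ᶠ n : ℕ in atTop, |ω * (τ / n)| ≤ Real.pi / 2 := by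
  have h : Tendsto (fun n : ℕ => |ω * (τ / n)|) atTop (𝓝 0) := by
    simpa using ((tendsto_const_div_atTop_nhds_zero_nat τ).const_mul ω).abs
  exact h.eventually (ge_mem_nhds (by positivity))

theorem gridTurning_rotate_le (α : ℝ) {τ ω : ℝ} (hτ : 0 ≤ τ) (g : ℝ → ℂ) {n : ℕ}
    (hn : |ω * (τ / n)| ≤ Real.pi / 2) :
    gridTurning α τ (fun s => Circle.exp (ω * s) * g s) n ≤
      gridTurning α τ g n + ENNReal.ofReal (2 * (|ω| * τ)) := by
  have h1 : ∀ k, separation (Circle.exp (ω * gridPoint α τ n k) * g (gridPoint α τ n k))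
      (Circle.exp (ω * gridPoint α τ n (k + 1)) * g (gridPoint α τ n (k + 1))) ≤
      separation (g (gridPoint α τ n k)) (g (gridPoint α τ n (k + 1))) +
        ENNReal.ofReal (2 * |ω * (τ / n)|) := by
    intro k
    refine (separation_triangle _
      (Circle.exp (ω * gridPoint α τ n k) * g (gridPoint α τ n (k + 1))) _).trans ?_
    refine add_le_add (separation_circleExp_mul _ _ _).le ?_
    have e : (Circle.exp (ω * gridPoint α τ n (k + 1)) : ℂ) * g (gridPoint α τ n (k + 1)) =
        Circle.exp (ω * gridPoint α τ n k) *
          (Circle.exp (ω * (τ / n)) * g (gridPoint α τ n (k + 1))) := by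
      rw [← mul_assoc, ← Circle.coe_mul, ← Circle.exp_add, ← mul_add, ← gridPoint_succ]
    rw [e, separation_circleExp_mul]
    exact separation_self_circleExp_mul_le _ hn
  refine (Finset.sum_le_sum fun k _ => h1 k).trans ?_
  rw [Finset.sum_add_distrib]
  refine add_le_add le_rfl ?_
  rw [Finset.sum_const, Finset.card_range, nsmul_eq_mul, ← ENNReal.ofReal_natCast,
    ← ENNReal.ofReal_mul (by positivity)]
  refine ENNReal.ofReal_le_ofReal ?_
  rw [abs_mul, abs_of_nonneg (show 0 ≤ τ / n by positivity)]
  rcases n.eq_zero_or_pos with rfl | hn0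
  · simp only [Nat.cast_zero, zero_mul]; positivity
  · have : (n : ℝ) ≠ 0 := by positivity
    refine le_of_eq ?_
    field_simp

theorem turning_rotate_le (α : ℝ) {τ : ℝ} (hτ : 0 ≤ τ) (ω : ℝ) (g : ℝ → ℂ) :
    turning α τ (fun s => Circle.exp (ω * s) * g s) ≤
      turning α τ g + ENNReal.ofReal (2 * (|ω| * τ)) := by
  refine (liminf_le_liminf ((eventually_abs_mul_div_le ω τ).mono fun n hn =>
    gridTurning_rotate_le α hτ g hn)).trans ?_
  exact (liminf_add_const atTop _ _ (by isBoundedDefault) (by isBoundedDefault)).le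

theorem turning_pos_mul (α τ : ℝ) {ρ : ℝ → ℝ} (hρ : ∀ s, 0 < ρ s) (g : ℝ → ℂ) :
    turning α τ (fun s => ρ s * g s) = turning α τ g := by
  have : gridTurning α τ (fun s => ρ s * g s) = gridTurning α τ g := by
    funext n
    simp only [gridTurning, separation, inHalfPlane_pos_mul (hρ _)]
  rw [turning, this, turning]

theorem exists_gridTurning_circleExp_eq (α : ℝ) {τ ω : ℝ} (hτ : 0 ≤ τ) (hω : 0 ≤ ω) :
    ∃ n, gridTurning α τ (fun s => Circle.exp (ω * s)) n = ENNReal.ofReal (2 * (ω * τ)) := by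
  obtain ⟨n, hn, hn0⟩ := ((eventually_abs_mul_div_le ω τ).and (eventually_gt_atTop 0)).exists
  refine ⟨n, ?_⟩
  have hn1 : (n : ℝ) ≠ 0 := by positivity
  have h1 : ∀ k, separation (Circle.exp (ω * gridPoint α τ n k))
      (Circle.exp (ω * gridPoint α τ n (k + 1))) = ENNReal.ofReal (2 * (ω * (τ / n))) := by
    intro k
    rw [← separation_one_circleExp (by positivity) ((le_abs_self _).trans hn),
      ← separation_circleExp_mul (ω * gridPoint α τ n k) 1, mul_one, ← Circle.coe_mul,
      ← Circle.exp_add, ← mul_add, ← gridPoint_succ]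
  rw [gridTurning, Finset.sum_congr rfl fun k _ => h1 k, Finset.sum_const, Finset.card_range,
    nsmul_eq_mul, ← ENNReal.ofReal_natCast, ← ENNReal.ofReal_mul (by positivity)]
  congr 1
  field_simp

/-! ### Output signals of linear systems -/

open Filter Topology

/-- The scalar output `s ↦ cᵀ exp(s A) z` of the complex linear system `ξ' = A ξ` started from
`z`. -/
noncomputable def outputSignal {d : ℕ} (A : Matrix (Fin d) (Fin d) ℂ) (c z : Fin d → ℂ) (s : ℝ) :
    ℂ :=
  c ⬝ᵥ (NormedSpace.exp (s • A)).mulVec z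

theorem exp_add_smul_matrix {𝕜 : Type*} [RCLike 𝕜] {d : ℕ} (A : Matrix (Fin d) (Fin d) 𝕜)
    (s t : ℝ) :
    NormedSpace.exp ((s + t) • A) = NormedSpace.exp (s • A) * NormedSpace.exp (t • A) := by
  rw [add_smul]
  exact Matrix.exp_add_of_commute _ _ (((Commute.refl A).smul_left s).smul_right t)

section OutputSignal

variable {d : ℕ} (A : Matrix (Fin d) (Fin d) ℂ) (c : Fin d → ℂ)

theorem outputSignal_add (z : Fin d → ℂ) (s t : ℝ) :
    outputSignal A c z (s + t) = outputSignal A c ((NormedSpace.exp (t • A)).mulVec z) s := by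
  rw [outputSignal, outputSignal, exp_add_smul_matrix, Matrix.mulVec_mulVec]

theorem outputSignal_zero (z : Fin d → ℂ) : outputSignal A c z 0 = c ⬝ᵥ z := by
  simp [outputSignal]

theorem hasDerivAt_outputSignal (z : Fin d → ℂ) (s : ℝ) :
    HasDerivAt (outputSignal A c z) (outputSignal A c (A.mulVec z) s) s := by
  let _ : NormedRing (Matrix (Fin d) (Fin d) ℂ) := Matrix.linftyOpNormedRing
  let _ : NormedAlgebra ℝ (Matrix (Fin d) (Fin d) ℂ) := Matrix.linftyOpNormedAlgebra
  have h1 : HasDerivAt (fun r : ℝ => NormedSpace.exp (r • A)) (NormedSpace.exp (s • A) * A) s :=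
    hasDerivAt_exp_smul_const (𝕂 := ℝ) A s
  let L : Matrix (Fin d) (Fin d) ℂ →ₗ[ℝ] ℂ :=
    { toFun := fun M => c ⬝ᵥ M.mulVec z
      map_add' := fun M N => by rw [Matrix.add_mulVec, dotProduct_add]
      map_smul' := fun r M => by rw [Matrix.smul_mulVec, dotProduct_smul]; rfl }
  have h2 := (L.toContinuousLinearMap.hasFDerivAt
    (x := NormedSpace.exp (s • A))).comp_hasDerivAt s h1
  rw [outputSignal, Matrix.mulVec_mulVec]
  exact h2

theorem continuous_outputSignal (z : Fin d → ℂ) : Continuous (outputSignal A c z) :=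
  continuous_iff_continuousAt.2 fun s => (hasDerivAt_outputSignal A c z s).continuousAt

theorem analyticOnNhd_outputSignal (z : Fin d → ℂ) :
    AnalyticOnNhd ℝ (outputSignal A c z) Set.univ := by
  intro s _
  let _ : NormedRing (Matrix (Fin d) (Fin d) ℂ) := Matrix.linftyOpNormedRing
  let _ : NormedAlgebra ℝ (Matrix (Fin d) (Fin d) ℂ) := Matrix.linftyOpNormedAlgebra
  let L : Matrix (Fin d) (Fin d) ℂ →ₗ[ℝ] ℂ :=
    { toFun := fun M => c ⬝ᵥ M.mulVec z
      map_add' := fun M N => by rw [Matrix.add_mulVec, dotProduct_add]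
      map_smul' := fun r M => by rw [Matrix.smul_mulVec, dotProduct_smul]; rfl }
  have h1 : AnalyticAt ℝ (fun r : ℝ => r • A) s := analyticAt_id.smul analyticAt_const
  have h2 : AnalyticAt ℝ (NormedSpace.exp : Matrix (Fin d) (Fin d) ℂ → _) (s • A) :=
    NormedSpace.exp_analytic (𝕂 := ℝ) _
  have h3 : AnalyticAt ℝ (fun r : ℝ => NormedSpace.exp (r • A)) s :=
    AnalyticAt.comp (f := fun r : ℝ => r • A) h2 h1
  exact (L.toContinuousLinearMap.analyticAt _).comp h3

theorem outputSignal_sub_scalar (lam : ℂ) (z : Fin d → ℂ) (s : ℝ) :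
    outputSignal (A - lam • (1 : Matrix (Fin d) (Fin d) ℂ)) c z s =
      Complex.exp (-lam * s) * outputSignal A c z s := by
  have e : s • (A - lam • (1 : Matrix (Fin d) (Fin d) ℂ)) =
      Matrix.diagonal (fun _ => -lam * s) + s • A := by
    rw [← Matrix.smul_one_eq_diagonal, smul_sub, neg_mul, neg_smul, mul_comm, mul_smul,
      Complex.coe_smul]
    abel
  have hcomm : Commute (Matrix.diagonal (fun _ : Fin d => -lam * s)) (s • A) := by
    rw [← Matrix.smul_one_eq_diagonal]
    exact (Commute.one_left _).smul_left _
  rw [outputSignal, e, Matrix.exp_add_of_commute _ _ hcomm, Matrix.exp_diagonal]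
  have e2 : NormedSpace.exp (fun _ : Fin d => -lam * s) = fun _ => Complex.exp (-lam * s) := by
    funext i
    rw [Pi.coe_exp, Complex.exp_eq_exp_ℂ]
  rw [e2, ← Matrix.smul_one_eq_diagonal, Matrix.smul_mul, one_mul, Matrix.smul_mulVec,
    dotProduct_smul, smul_eq_mul, outputSignal]

theorem outputSignal_eq_zero_of_eventually {z : Fin d → ℂ} {s₀ : ℝ}
    (h : ∀ᶠ s in 𝓝 s₀, outputSignal A c z s = 0) (s : ℝ) : outputSignal A c z s = 0 :=
  (analyticOnNhd_outputSignal A c z).eqOn_zero_of_preconnected_of_eventuallyEq_zero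
    isPreconnected_univ (Set.mem_univ s₀) h (Set.mem_univ s)

theorem outputSignal_const {z : Fin d → ℂ} (h : A.mulVec z = 0) (s : ℝ) :
    outputSignal A c z s = c ⬝ᵥ z := by
  rw [← outputSignal_zero A c z]
  refine is_const_of_deriv_eq_zero (fun s => (hasDerivAt_outputSignal A c z s).differentiableAt)
    (fun s => ?_) s 0
  rw [(hasDerivAt_outputSignal A c z s).deriv, h]
  simp [outputSignal]

end OutputSignal

theorem Complex.exp_mul_ofReal_eq (w : ℂ) (s : ℝ) :
    Complex.exp (w * s) = (Real.exp (w.re * s) : ℂ) * Circle.exp (w.im * s) := by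
  rw [Circle.coe_exp, Complex.ofReal_exp, ← Complex.exp_add]
  congr 1
  conv_lhs => rw [← Complex.re_add_im w]
  push_cast
  ring

/-! ### Zeros of outputs on a bounded interval -/

open Filter Topology MeasureTheory Polynomial
open scoped ENNReal

/-- Changing the reference eigenvalue costs a rotation by the difference of the imaginary parts. -/
theorem turning_outputSignal_le_of_shift {d : ℕ} (A : Matrix (Fin d) (Fin d) ℂ) (c z : Fin d → ℂ)
    (α : ℝ) {τ : ℝ} (hτ : 0 ≤ τ) {lam mu : ℂ} (h : lam.im ≤ mu.im) :
    turning α τ (outputSignal (A - lam • (1 : Matrix (Fin d) (Fin d) ℂ)) c z) ≤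
      turning α τ (outputSignal (A - mu • (1 : Matrix (Fin d) (Fin d) ℂ)) c z) +
        ENNReal.ofReal (2 * ((mu.im - lam.im) * τ)) := by
  have e : outputSignal (A - lam • (1 : Matrix (Fin d) (Fin d) ℂ)) c z = fun s : ℝ =>
      (Real.exp ((mu - lam).re * s) : ℂ) * ((Circle.exp ((mu - lam).im * s) : ℂ) *
        outputSignal (A - mu • (1 : Matrix (Fin d) (Fin d) ℂ)) c z s) := by
    funext s
    rw [← mul_assoc, ← Complex.exp_mul_ofReal_eq, outputSignal_sub_scalar, outputSignal_sub_scalar,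
      ← mul_assoc, ← Complex.exp_add]
    congr 2
    ring
  rw [e, turning_pos_mul α τ (ρ := fun s => Real.exp ((mu - lam).re * s))
    (fun s => Real.exp_pos _)]
  refine (turning_rotate_le α hτ _ _).trans ?_
  rw [Complex.sub_im, abs_of_nonneg (sub_nonneg.2 h)]

theorem aeval_prod_cons_mulVec {d : ℕ} (A : Matrix (Fin d) (Fin d) ℂ) (lam : ℂ) (L : List ℂ)
    (z : Fin d → ℂ) :
    (aeval A ((lam :: L).map fun mu => X - C mu).prod).mulVec z =
      (aeval A (L.map fun mu => X - C mu).prod).mulVec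
        ((A - lam • (1 : Matrix (Fin d) (Fin d) ℂ)).mulVec z) := by
  rw [List.map_cons, List.prod_cons, mul_comm, map_mul, ← Matrix.mulVec_mulVec]
  simp [Algebra.algebraMap_eq_smul_one]

/-- Upper bound for the turning of an output: removing the eigenvalues one at a time, in the order
of their imaginary parts, costs half a turn each by Rolle's theorem, and the rotations in between
add up to the spread of the imaginary parts. -/
theorem turning_outputSignal_le {d : ℕ} (A : Matrix (Fin d) (Fin d) ℂ) (c : Fin d → ℂ)
    (α : ℝ) {τ M : ℝ} (hτ : 0 ≤ τ) (L : List ℂ) : ∀ (lam : ℂ) (z : Fin d → ℂ),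
    (lam :: L).Pairwise (fun x y => x.im ≤ y.im) → (∀ mu ∈ lam :: L, mu.im ≤ M) →
    (aeval A ((lam :: L).map fun mu => X - C mu).prod).mulVec z = 0 →
    turning α τ (outputSignal (A - lam • (1 : Matrix (Fin d) (Fin d) ℂ)) c z) ≤
      ENNReal.ofReal (2 * Real.pi * L.length + 2 * ((M - lam.im) * τ)) := by
  induction L with
  | nil =>
    intro lam z _ _ hz
    rw [aeval_prod_cons_mulVec] at hz
    simp only [List.map_nil, List.prod_nil, map_one, Matrix.one_mulVec] at hz
    have e : outputSignal (A - lam • (1 : Matrix (Fin d) (Fin d) ℂ)) c z = fun _ => c ⬝ᵥ z :=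
      funext fun s => outputSignal_const _ c hz s
    rw [e, turning_const]
    exact zero_le
  | cons mu L ih =>
    intro lam z hp hM hz
    rw [aeval_prod_cons_mulVec] at hz
    have him : lam.im ≤ mu.im := (List.pairwise_cons.1 hp).1 mu (by simp)
    have h1 := ih mu _ (List.pairwise_cons.1 hp).2 (fun x hx => hM x (List.mem_cons_of_mem _ hx)) hz
    have hmuM : mu.im ≤ M := hM mu (by simp)
    refine (turning_le_turning_deriv_add hτ (hasDerivAt_outputSignal _ c z)
      (continuous_outputSignal _ c _)).trans ?_
    refine (add_le_add_left ((turning_outputSignal_le_of_shift A c _ α hτ him).trans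
      (add_le_add_left h1 _)) _).trans ?_
    have p1 : 0 ≤ (M - mu.im) * τ := mul_nonneg (by linarith) hτ
    have p2 : 0 ≤ (mu.im - lam.im) * τ := mul_nonneg (by linarith) hτ
    have p3 := Real.pi_pos
    rw [← ENNReal.ofReal_add (by positivity) (by positivity),
      ← ENNReal.ofReal_add (by positivity) (by positivity)]
    refine ENNReal.ofReal_le_ofReal (le_of_eq ?_)
    rw [List.length_cons]
    push_cast
    ring

/-- Sign changes of `κ` along a grid give additional points where `κ` vanishes. -/
theorem exists_finset_card_eq_add_flipCount {α τ : ℝ} (hτ : 0 ≤ τ) {κ : ℝ → ℝ}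
    (hκ : Continuous κ) (m : ℕ) (hm : ∀ k ≤ m, κ (gridPoint α τ m k) ≠ 0) (Z : Finset ℝ)
    (hZ : ∀ x ∈ Z, x ∈ Set.Icc α (α + τ) ∧ κ x ≠ 0) :
    ∃ Z' : Finset ℝ, Z'.card = Z.card + flipCount (fun k => 0 < κ (gridPoint α τ m k)) m ∧
      ∀ x ∈ Z', x ∈ Set.Icc α (α + τ) ∧ (x ∈ Z ∨ κ x = 0) := by
  classical
  have hex : ∀ k, ∃ η, k < m → ¬(0 < κ (gridPoint α τ m k) ↔ 0 < κ (gridPoint α τ m (k + 1))) →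
      η ∈ Set.Ioo (gridPoint α τ m k) (gridPoint α τ m (k + 1)) ∧ κ η = 0 := by
    intro k
    by_cases hk : k < m
    swap
    · exact ⟨0, fun h => absurd h hk⟩
    by_cases hB : 0 < κ (gridPoint α τ m k) ↔ 0 < κ (gridPoint α τ m (k + 1))
    · exact ⟨0, fun _ h => absurd hB h⟩
    have hle := gridPoint_mono (α := α) hτ m (Nat.le_succ k)
    have h0 := hm k hk.le
    have h1 := hm (k + 1) hk
    rcases h0.lt_or_gt with h0 | h0
    · have h1' : 0 < κ (gridPoint α τ m (k + 1)) := by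
        by_contra h; exact hB (iff_of_false h0.not_gt h)
      obtain ⟨η, hη, h⟩ := intermediate_value_Ioo hle hκ.continuousOn ⟨h0, h1'⟩
      exact ⟨η, fun _ _ => ⟨hη, h⟩⟩
    · have h1' : κ (gridPoint α τ m (k + 1)) < 0 := by
        refine lt_of_le_of_ne (not_lt.1 fun h => hB (iff_of_true h0 h)) h1
      obtain ⟨η, hη, h⟩ := intermediate_value_Ioo' hle hκ.continuousOn ⟨h1', h0⟩
      exact ⟨η, fun _ _ => ⟨hη, h⟩⟩
  choose η hη using hex
  set S := (Finset.range m).filter fun k =>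
    ¬(0 < κ (gridPoint α τ m k) ↔ 0 < κ (gridPoint α τ m (k + 1))) with hS
  have hSη : ∀ k ∈ S, k < m ∧ η k ∈ Set.Ioo (gridPoint α τ m k) (gridPoint α τ m (k + 1)) ∧
      κ (η k) = 0 := by
    intro k hk
    have := Finset.mem_filter.1 hk
    exact ⟨Finset.mem_range.1 this.1, hη k (Finset.mem_range.1 this.1) this.2⟩
  have hlt : ∀ k ∈ S, ∀ k' ∈ S, k < k' → η k < η k' := by
    intro k hk k' hk' h
    exact (hSη k hk).2.1.2.trans_le
      ((gridPoint_mono hτ m (Nat.succ_le_of_lt h)).trans (hSη k' hk').2.1.1.le)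
  have hinj : Set.InjOn η S := by
    intro k hk k' hk' h
    rcases lt_trichotomy k k' with h1 | h1 | h1
    · exact absurd h (hlt k hk k' hk' h1).ne
    · exact h1
    · exact absurd h (hlt k' hk' k hk h1).ne'
  refine ⟨Z ∪ S.image η, ?_, ?_⟩
  · rw [Finset.card_union_of_disjoint, Finset.card_image_of_injOn hinj]
    · congr 1
    · rw [Finset.disjoint_left]
      intro x hx hx'
      obtain ⟨k, hk, rfl⟩ := Finset.mem_image.1 hx'
      exact (hZ _ hx).2 (hSη k hk).2.2
  · intro x hx
    rcases Finset.mem_union.1 hx with hx | hx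
    · exact ⟨(hZ x hx).1, Or.inl hx⟩
    · obtain ⟨k, hk, rfl⟩ := Finset.mem_image.1 hx
      obtain ⟨hkm, h1, h2⟩ := hSη k hk
      exact ⟨⟨(gridPoint_mem_Icc hτ hkm.le).1.trans h1.1.le,
        h1.2.le.trans (gridPoint_mem_Icc hτ hkm).2⟩, Or.inr h2⟩

/-- Lower bound for the turning: the component of `exp(-λ s) f(s)` in the direction `θ` vanishes
at the zeros of the real function `f` and, for almost every `θ` elsewhere, at the zeros of a cosine
of frequency `|Im λ|`. Between consecutive zeros its derivative changes sign. -/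
theorem le_turning_outputSignal {d : ℕ} (A : Matrix (Fin d) (Fin d) ℂ) (c z : Fin d → ℂ)
    {α τ : ℝ} (hτ : 0 ≤ τ) {lam : ℂ} (hlam : lam.im ≤ 0) {f : ℝ → ℝ}
    (hf : ∀ s, outputSignal A c z s = f s) (hne : ∃ s, f s ≠ 0) (Z : Finset ℝ)
    (hZ : ∀ x ∈ Z, x ∈ Set.Icc α (α + τ) ∧ f x = 0) :
    ENNReal.ofReal (2 * Real.pi * Z.card + 2 * (-lam.im * τ)) ≤
      turning α τ (outputSignal (A - lam • (1 : Matrix (Fin d) (Fin d) ℂ)) c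
        ((A - lam • (1 : Matrix (Fin d) (Fin d) ℂ)).mulVec z)) +
          ENNReal.ofReal (2 * Real.pi) := by
  obtain ⟨m, hm⟩ := exists_gridTurning_circleExp_eq α hτ (neg_nonneg.2 hlam)
  have hint : ∫⁻ θ, ((Z.card + flipCount (fun k => InHalfPlane θ
      (Circle.exp (-lam.im * gridPoint α τ m k))) m : ℕ) : ℝ≥0∞) =
        ENNReal.ofReal (2 * Real.pi * Z.card + 2 * (-lam.im * τ)) := by
    have hp := Real.pi_pos
    have hl := mul_nonneg (neg_nonneg.2 hlam) hτ
    simp only [Nat.cast_add]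
    rw [lintegral_add_left measurable_const, lintegral_flipCount_inHalfPlane α τ
      (fun s => (Circle.exp (-lam.im * s) : ℂ)), hm, lintegral_const,
      AddCircle.measure_univ, ← ENNReal.ofReal_natCast, ← ENNReal.ofReal_mul (by positivity),
      ← ENNReal.ofReal_add (by positivity) (by positivity), mul_comm (Z.card : ℝ)]
  rw [← hint]
  refine lintegral_le_turning_add ?_
  have h1 : ∀ᵐ θ : AddCircle (2 * Real.pi), ∀ x ∈ Z,
      ((AddCircle.toCircle θ : ℂ) * Circle.exp (-lam.im * x)).re ≠ 0 :=
    (Finset.eventually_all Z).2 fun x _ => ae_re_toCircle_mul_ne_zero (Circle.coe_ne_zero _)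
  have h2 : ∀ᵐ θ : AddCircle (2 * Real.pi), ∀ k : ℕ,
      ((AddCircle.toCircle θ : ℂ) * Circle.exp (-lam.im * gridPoint α τ m k)).re ≠ 0 :=
    ae_all_iff.2 fun k => ae_re_toCircle_mul_ne_zero (Circle.coe_ne_zero _)
  filter_upwards [h1, h2] with θ hθ1 hθ2
  set κ : ℝ → ℝ := fun s => ((AddCircle.toCircle θ : ℂ) * Circle.exp (-lam.im * s)).re with hκdef
  have hκ : Continuous κ := by
    refine Complex.continuous_re.comp (continuous_const.mul ?_)
    exact continuous_subtype_val.comp (Circle.exp.continuous.comp (continuous_const.mul continuous_id))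
  set v : ℝ → ℝ := fun s => ((AddCircle.toCircle θ : ℂ) *
    outputSignal (A - lam • (1 : Matrix (Fin d) (Fin d) ℂ)) c z s).re with hvdef
  have hv : ∀ s, v s = Real.exp (-lam.re * s) * f s * κ s := by
    intro s
    simp only [hvdef, hκdef]
    rw [outputSignal_sub_scalar, hf, Complex.exp_mul_ofReal_eq, Complex.neg_re, Complex.neg_im,
      ← Complex.re_ofReal_mul]
    congr 1
    push_cast
    ring
  have hF : ∀ s₀, ¬∀ᶠ s in 𝓝 s₀, f s = 0 := by
    intro s₀ h
    obtain ⟨s, hs⟩ := hne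
    apply hs
    have := outputSignal_eq_zero_of_eventually A c (z := z) (s₀ := s₀)
      (h.mono fun s hs => by rw [hf, hs, Complex.ofReal_zero]) s
    rw [hf] at this
    exact_mod_cast this
  have hvan : AnalyticOnNhd ℝ v Set.univ := by
    intro s hs
    exact (Complex.reCLM.analyticAt _).comp
      (analyticAt_const.mul (analyticOnNhd_outputSignal _ c z s hs))
  have hvne : ∀ a b, a < b → ∃ y ∈ Set.Ioo a b, v y ≠ 0 := by
    intro a b hab
    by_contra! hcon
    obtain ⟨y, hy⟩ := exists_between hab
    have hv0 : ∀ s, v s = 0 := fun s =>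
      hvan.eqOn_zero_of_preconnected_of_eventuallyEq_zero isPreconnected_univ (Set.mem_univ y)
        (Filter.mem_of_superset (Ioo_mem_nhds hy.1 hy.2) hcon) (Set.mem_univ s)
    refine hF (gridPoint α τ m 0) ?_
    filter_upwards [(hκ.tendsto _).eventually_ne (hθ2 0)] with s hs
    have h3 := hv s
    rw [hv0 s] at h3
    have h4 := (mul_eq_zero.1 h3.symm).resolve_right hs
    exact (mul_eq_zero.1 h4).resolve_left (Real.exp_pos _).ne'
  obtain ⟨Z', hcard, hZ'⟩ := exists_finset_card_eq_add_flipCount hτ hκ m (fun k _ => hθ2 k) Z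
    fun x hx => ⟨(hZ x hx).1, hθ1 x hx⟩
  have hmain := eventually_card_zeros_le_flipCount_deriv hτ (v := v)
    (fun s => Complex.reCLM.hasFDerivAt.comp_hasDerivAt s
      ((hasDerivAt_outputSignal (A - lam • (1 : Matrix (Fin d) (Fin d) ℂ)) c z s).const_mul
        (AddCircle.toCircle θ : ℂ)))
    (Complex.continuous_re.comp (continuous_const.mul (continuous_outputSignal _ c _)))
    hvne Z' (fun x hx => ⟨(hZ' x hx).1, by
      rw [hv]
      rcases (hZ' x hx).2 with h | h
      · rw [(hZ x h).2]; ring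
      · rw [h, mul_zero]⟩)
  rw [hcard] at hmain
  exact hmain

/-- A real output that is not identically zero has at most `n - 1 + τ M / π` distinct zeros in an
interval of length `τ`, if a product of `n` factors `A - μ`, all with `Im μ ≤ M` and the one of
least imaginary part with `Im μ ≤ 0`, annihilates the initial state. -/
theorem card_zeros_outputSignal_le {d : ℕ} (A : Matrix (Fin d) (Fin d) ℂ) (c z : Fin d → ℂ)
    {α τ M : ℝ} (hτ : 0 ≤ τ) (hM0 : 0 ≤ M) {L : List ℂ} (hL : L.Pairwise fun x y => x.im ≤ y.im)
    (hM : ∀ mu ∈ L, mu.im ≤ M) (hneg : ∀ mu ∈ L.head?, mu.im ≤ 0)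
    (hz : (aeval A (L.map fun mu => X - C mu).prod).mulVec z = 0) {f : ℝ → ℝ}
    (hf : ∀ s, outputSignal A c z s = f s) (hne : ∃ s, f s ≠ 0) (Z : Finset ℝ)
    (hZ : ∀ x ∈ Z, x ∈ Set.Icc α (α + τ) ∧ f x = 0) :
    (Z.card : ℝ) ≤ L.length - 1 + τ * M / Real.pi := by
  have hpi := Real.pi_pos
  match L, hL, hM, hneg, hz with
  | [], _, _, _, hz =>
    obtain ⟨s, hs⟩ := hne
    simp only [List.map_nil, List.prod_nil, map_one, Matrix.one_mulVec] at hz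
    have := hf s
    simp only [hz, outputSignal, Matrix.mulVec_zero, dotProduct_zero] at this
    exact absurd (by exact_mod_cast this.symm) hs
  | [lam], _, _, _, hz =>
    rw [aeval_prod_cons_mulVec] at hz
    simp only [List.map_nil, List.prod_nil, map_one, Matrix.one_mulVec] at hz
    have hc : ∀ s : ℝ, Complex.exp (-lam * s) * f s = c ⬝ᵥ z := by
      intro s
      rw [← hf, ← outputSignal_sub_scalar]
      exact outputSignal_const _ c hz s
    have hZ0 : Z = ∅ := by
      rw [Finset.eq_empty_iff_forall_notMem]
      intro x hx
      obtain ⟨s, hs⟩ := hne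
      have h1 := hc s
      rw [← hc x, (hZ x hx).2, Complex.ofReal_zero, mul_zero] at h1
      exact hs (by exact_mod_cast (mul_eq_zero.1 h1).resolve_left (Complex.exp_ne_zero _))
    have : 0 ≤ τ * M / Real.pi := by positivity
    simpa [hZ0] using this
  | lam :: mu :: L, hL, hM, hneg, hz =>
    rw [aeval_prod_cons_mulVec] at hz
    have hneg' : lam.im ≤ 0 := hneg lam (by simp)
    have him : lam.im ≤ mu.im := (List.pairwise_cons.1 hL).1 mu (by simp)
    have hmuM : mu.im ≤ M := hM mu (by simp)
    have h1 := turning_outputSignal_le A c α hτ L mu _ (List.pairwise_cons.1 hL).2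
      (fun x hx => hM x (List.mem_cons_of_mem _ hx)) hz
    have h2 := (le_turning_outputSignal A c z hτ hneg' hf hne Z hZ).trans
      (add_le_add_left ((turning_outputSignal_le_of_shift A c _ α hτ him).trans
        (add_le_add_left h1 _)) _)
    have p1 : 0 ≤ (M - mu.im) * τ := mul_nonneg (by linarith) hτ
    have p2 : 0 ≤ (mu.im - lam.im) * τ := mul_nonneg (by linarith) hτ
    rw [← ENNReal.ofReal_add (by positivity) (by positivity),
      ← ENNReal.ofReal_add (by positivity) (by positivity),
      ENNReal.ofReal_le_ofReal_iff (by positivity)] at h2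
    have h3 : (Z.card : ℝ) * Real.pi ≤ (L.length + 1) * Real.pi + τ * M := by nlinarith
    rw [List.length_cons, List.length_cons]
    push_cast
    have h4 : ((L.length : ℝ) + 1 + 1 - 1 + τ * M / Real.pi) * Real.pi =
        (L.length + 1) * Real.pi + τ * M := by field_simp; ring
    exact le_of_mul_le_mul_right (h3.trans_eq h4.symm) hpi

/-! ### Sampling along arithmetic progressions -/

open Filter Topology Polynomial

section Progression

variable {d : ℕ} (A : Matrix (Fin d) (Fin d) ℂ) (c : Fin d → ℂ)

/-- By the Cayley–Hamilton theorem, `d` consecutive samples determine all others. -/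
theorem dotProduct_aeval_mulVec_eq_zero {M : Matrix (Fin d) (Fin d) ℂ} {c w : Fin d → ℂ}
    (h : ∀ k < d, c ⬝ᵥ (M ^ k).mulVec w = 0) (p : ℂ[X]) : c ⬝ᵥ (aeval M p).mulVec w = 0 := by
  rcases d.eq_zero_or_pos with rfl | hd
  · simp [dotProduct]
  have hdeg : (p %ₘ M.charpoly).natDegree < d := by
    have h1 := M.charpoly_monic
    have h2 : M.charpoly.natDegree = d := by simp [Matrix.charpoly_natDegree_eq_dim]
    have h3 := natDegree_modByMonic_lt p h1 (by
      intro h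
      rw [h, natDegree_one] at h2
      omega)
    rwa [h2] at h3
  rw [Matrix.aeval_eq_aeval_mod_charpoly, aeval_eq_sum_range' hdeg, Matrix.sum_mulVec,
    dotProduct_sum]
  refine Finset.sum_eq_zero fun k hk => ?_
  rw [Matrix.smul_mulVec, dotProduct_smul, h k (Finset.mem_range.1 hk), smul_zero]

theorem exp_natCast_mul_smul_matrix (h : ℝ) (k : ℕ) :
    NormedSpace.exp (((k : ℝ) * h) • A) = NormedSpace.exp (h • A) ^ k := by
  rw [mul_smul, Nat.cast_smul_eq_nsmul, Matrix.exp_nsmul]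

/-- An inverse of a matrix is a polynomial in the matrix, so all integer powers of `exp(h A)` are
polynomials in `exp(h A)`. -/
theorem exists_aeval_eq_exp_intCast_mul_smul (h : ℝ) (r : ℤ) :
    ∃ p : ℂ[X], NormedSpace.exp (((r : ℝ) * h) • A) = aeval (NormedSpace.exp (h • A)) p := by
  set M := NormedSpace.exp (h • A) with hM
  set N := NormedSpace.exp ((-h) • A) with hN
  have hMN : N * M = 1 := by
    rw [hM, hN, ← exp_add_smul_matrix, neg_add_cancel, zero_smul, NormedSpace.exp_zero]
  have hq : ∃ q : ℂ[X], N = aeval M q := by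
    have hc0 : M.charpoly.coeff 0 ≠ 0 := by
      intro h0
      have hdet := M.det_eq_sign_charpoly_coeff
      rw [h0, mul_zero] at hdet
      have h1 := congrArg Matrix.det hMN
      rw [Matrix.det_mul, hdet, mul_zero, Matrix.det_one] at h1
      exact zero_ne_one h1
    have h1 := M.aeval_self_charpoly
    rw [← divX_mul_X_add M.charpoly, map_add, map_mul, aeval_X, aeval_C] at h1
    have hMN' : M * N = 1 := by
      rw [hM, hN, ← exp_add_smul_matrix, add_neg_cancel, zero_smul, NormedSpace.exp_zero]
    have h2 := congrArg (· * N) h1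
    simp only [add_mul, mul_assoc, hMN', mul_one, zero_mul] at h2
    refine ⟨C (-(M.charpoly.coeff 0)⁻¹) * M.charpoly.divX, ?_⟩
    rw [map_mul, aeval_C, eq_neg_of_add_eq_zero_left h2, mul_neg, ← mul_assoc, ← map_mul, ← neg_mul,
      ← map_neg, neg_mul, neg_neg, inv_mul_cancel₀ hc0, map_one, one_mul]
  obtain ⟨k, rfl | rfl⟩ := r.eq_nat_or_neg
  · refine ⟨X ^ k, ?_⟩
    rw [Int.cast_natCast, exp_natCast_mul_smul_matrix, map_pow, aeval_X]
  · obtain ⟨q, hq⟩ := hq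
    refine ⟨q ^ k, ?_⟩
    rw [map_pow, ← hq, hN, ← exp_natCast_mul_smul_matrix]
    congr 2
    push_cast
    ring

/-- An output that vanishes on a `d × d` block of the grid `ℕ h + ℕ P` vanishes on the group
generated by `h` and `P`, which is dense if `h` and `P` are incommensurable. -/
theorem outputSignal_eq_zero_of_doubly_periodic {h h' P : ℝ} (hirr : Irrational (h / h')) {b : ℕ}
    (hP : P = b * h + h') {w : Fin d → ℂ}
    (hw : ∀ r < d, ∀ j < d, outputSignal A c w (r * h + j * P) = 0) (s : ℝ) :
    outputSignal A c w s = 0 := by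
  set M := NormedSpace.exp (h • A) with hM
  set N := NormedSpace.exp (P • A) with hN
  have h1 : ∀ p q : ℂ[X], c ⬝ᵥ (aeval M p).mulVec ((aeval N q).mulVec w) = 0 := by
    intro p q
    rw [Matrix.dotProduct_mulVec]
    refine dotProduct_aeval_mulVec_eq_zero (fun j hj => ?_) q
    rw [← Matrix.dotProduct_mulVec]
    refine dotProduct_aeval_mulVec_eq_zero (fun r hr => ?_) p
    have := hw r hr j hj
    rwa [outputSignal, exp_add_smul_matrix, exp_natCast_mul_smul_matrix,
      exp_natCast_mul_smul_matrix, ← Matrix.mulVec_mulVec] at this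
  have h2 : ∀ r j : ℤ, outputSignal A c w (r * h + j * P) = 0 := by
    intro r j
    obtain ⟨p, hp⟩ := exists_aeval_eq_exp_intCast_mul_smul A h r
    obtain ⟨q, hq⟩ := exists_aeval_eq_exp_intCast_mul_smul A P j
    rw [outputSignal, exp_add_smul_matrix, hp, hq, ← Matrix.mulVec_mulVec]
    exact h1 p q
  have hdense := dense_addSubgroupClosure_pair_iff.2 hirr
  have hclosed : IsClosed {s | outputSignal A c w s = 0} :=
    isClosed_eq (continuous_outputSignal A c w) continuous_const
  have hsub : (AddSubgroup.closure {h, h'} : Set ℝ) ⊆ {s | outputSignal A c w s = 0} := by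
    intro s hs
    obtain ⟨r, j, rfl⟩ := AddSubgroup.mem_closure_pair.1 hs
    have := h2 (r - j * b) j
    have e : ((r - j * b : ℤ) : ℝ) * h + (j : ℝ) * P = r • h + j • h' := by
      rw [hP]; push_cast; simp only [zsmul_eq_mul]; ring
    rwa [e] at this
  exact hclosed.closure_subset_iff.2 hsub (hdense s)

/-- On a vector annihilated by a power of `A` the output is a polynomial in time. -/
theorem exists_polynomial_outputSignal {w : Fin d → ℂ} {k : ℕ} (h : (A ^ k).mulVec w = 0) :
    ∃ p : ℂ[X], ∀ s : ℝ, outputSignal A c w s = p.eval (s : ℂ) := by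
  let _ : NormedRing (Matrix (Fin d) (Fin d) ℂ) := Matrix.linftyOpNormedRing
  let _ : NormedAlgebra ℝ (Matrix (Fin d) (Fin d) ℂ) := Matrix.linftyOpNormedAlgebra
  let L : Matrix (Fin d) (Fin d) ℂ →ₗ[ℝ] ℂ :=
    { toFun := fun M => c ⬝ᵥ M.mulVec w
      map_add' := fun M N => by rw [Matrix.add_mulVec, dotProduct_add]
      map_smul' := fun r M => by rw [Matrix.smul_mulVec, dotProduct_smul]; rfl }
  refine ⟨∑ n ∈ Finset.range k, C ((n.factorial : ℂ)⁻¹ * (c ⬝ᵥ (A ^ n).mulVec w)) * X ^ n,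
    fun s => ?_⟩
  have h1 := (NormedSpace.exp_series_hasSum_exp' (𝕂 := ℝ) (s • A)).mapL L.toContinuousLinearMap
  have hterm : ∀ n : ℕ, L.toContinuousLinearMap (((n.factorial : ℝ)⁻¹) • (s • A) ^ n) =
      (n.factorial : ℂ)⁻¹ * (c ⬝ᵥ (A ^ n).mulVec w) * (s : ℂ) ^ n := by
    intro n
    rw [map_smul, _root_.smul_pow, map_smul]
    change ((n.factorial : ℝ)⁻¹) • (s ^ n • (c ⬝ᵥ (A ^ n).mulVec w)) = _
    simp only [Complex.real_smul]
    push_cast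
    ring
  simp only [hterm] at h1
  have h2 : HasSum (fun n : ℕ => (n.factorial : ℂ)⁻¹ * (c ⬝ᵥ (A ^ n).mulVec w) * (s : ℂ) ^ n)
      (∑ n ∈ Finset.range k, (n.factorial : ℂ)⁻¹ * (c ⬝ᵥ (A ^ n).mulVec w) * (s : ℂ) ^ n) := by
    refine hasSum_sum_of_ne_finset_zero fun n hn => ?_
    have hkn : k ≤ n := by simpa using hn
    rw [← Nat.sub_add_cancel hkn, pow_add, ← Matrix.mulVec_mulVec, h]
    simp
  have h3 := h1.unique h2
  change outputSignal A c w s = _ at h3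
  rw [h3, eval_finsetSum]
  refine Finset.sum_congr rfl fun n _ => ?_
  simp

theorem exp_smul_mulVec_of_eigenvector {w : Fin d → ℂ} {lam : ℂ} (h : A.mulVec w = lam • w)
    (s : ℝ) : (NormedSpace.exp (s • A)).mulVec w = Complex.exp (s * lam) • w := by
  refine dotProduct_eq _ _ fun c => ?_
  have h0 : (A - lam • (1 : Matrix (Fin d) (Fin d) ℂ)).mulVec w = 0 := by
    rw [Matrix.sub_mulVec, h, Matrix.smul_mulVec, Matrix.one_mulVec, sub_self]
  have h1 := outputSignal_const _ c h0 s
  rw [outputSignal_sub_scalar] at h1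
  rw [dotProduct_comm, dotProduct_comm (Complex.exp (s * lam) • w), dotProduct_smul, ← h1,
    smul_eq_mul, ← mul_assoc, ← Complex.exp_add]
  rw [show (s : ℂ) * lam + -lam * s = 0 by ring, Complex.exp_zero, one_mul, outputSignal]

end Progression

/-- Let `g` commute with `f` and act on the eigenvectors of `f` through a function `φ` that is
injective on the eigenvalues of `f`. Then generalised eigenspaces of `g` are contained in those of
`f`: such a space is `f`-invariant, and `f` has at most one eigenvalue on it. -/
theorem exists_maxGenEigenspace_le {V : Type*} [AddCommGroup V] [Module ℂ V]
    [FiniteDimensional ℂ V] {f g : Module.End ℂ V} (hcomm : Commute g f) {φ : ℂ → ℂ}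
    (hφ : ∀ w lam, f w = lam • w → g w = φ lam • w)
    (hinj : ∀ a b, f.HasEigenvalue a → f.HasEigenvalue b → φ a = φ b → a = b) (mu : ℂ) :
    ∃ lam, g.maxGenEigenspace mu ≤ f.maxGenEigenspace lam := by
  set G := g.maxGenEigenspace mu with hG
  have hinv : Set.MapsTo f G G := Module.End.mapsTo_maxGenEigenspace_of_comm hcomm mu
  have hsup : G = ⨆ lam, G ⊓ f.maxGenEigenspace lam :=
    Submodule.eq_iSup_inf_genEigenspace ⊤ hinv (Module.End.iSup_maxGenEigenspace_eq_top f)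
  have key : ∀ lam, G ⊓ f.maxGenEigenspace lam ≠ ⊥ → f.HasEigenvalue lam ∧ φ lam = mu := by
    classical
    intro lam hne
    obtain ⟨w, hw, hw0⟩ := Submodule.exists_mem_ne_zero_of_ne_bot hne
    have hex := (Module.End.mem_maxGenEigenspace f lam w).1 hw.2
    set k := Nat.find hex with hk
    have hk0 : k ≠ 0 := by
      intro h0
      have := Nat.find_spec hex
      rw [← hk, h0, pow_zero] at this
      exact hw0 this
    set v := ((f - lam • 1) ^ (k - 1)) w with hv
    have hv0 : v ≠ 0 := Nat.find_min hex (by omega)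
    have hfv : f v = lam • v := by
      have h1 : ((f - lam • 1) ^ (k - 1 + 1)) w = 0 := by
        rw [Nat.sub_add_cancel (Nat.one_le_iff_ne_zero.2 hk0)]; exact Nat.find_spec hex
      rw [pow_succ', Module.End.mul_apply, ← hv] at h1
      simpa [sub_eq_zero] using h1
    have hinv' : ∀ n : ℕ, ((f - lam • (1 : Module.End ℂ V)) ^ n) w ∈ G := by
      intro n
      induction n with
      | zero => exact hw.1
      | succ n ih =>
        rw [pow_succ', Module.End.mul_apply]
        exact G.sub_mem (hinv ih) (G.smul_mem _ ih)
    have hvG : v ∈ G := hinv' _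
    refine ⟨Module.End.hasEigenvalue_of_hasEigenvector
      (Module.End.hasEigenvector_iff.2 ⟨Module.End.mem_eigenspace_iff.2 hfv, hv0⟩), ?_⟩
    have hgv := hφ v lam hfv
    have hpow : ∀ n, ((g - mu • 1) ^ n) v = (φ lam - mu) ^ n • v := by
      intro n
      induction n with
      | zero => simp
      | succ n ih =>
        rw [pow_succ', Module.End.mul_apply, ih, map_smul]
        simp only [LinearMap.sub_apply, LinearMap.smul_apply, Module.End.one_apply, hgv,
          ← sub_smul, smul_smul, pow_succ]
    obtain ⟨n, hn⟩ := (Module.End.mem_maxGenEigenspace g mu v).1 hvG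
    rw [hpow, smul_eq_zero] at hn
    exact sub_eq_zero.1 (eq_zero_of_pow_eq_zero (hn.resolve_right hv0))
  by_cases hex : ∃ lam, G ⊓ f.maxGenEigenspace lam ≠ ⊥
  · obtain ⟨lam, hlam⟩ := hex
    refine ⟨lam, ?_⟩
    rw [hsup]
    refine iSup_le fun nu => ?_
    by_cases hnu : G ⊓ f.maxGenEigenspace nu = ⊥
    · rw [hnu]; exact bot_le
    · obtain ⟨h1, h2⟩ := key lam hlam
      obtain ⟨h3, h4⟩ := key nu hnu
      rw [hinj lam nu h1 h3 (h2.trans h4.symm)]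
      exact inf_le_right
  · push Not at hex
    refine ⟨0, ?_⟩
    rw [hsup]
    simp [hex]

/-- Under non-pathological equidistant sampling, an output vanishing at all multiples of the
sampling period vanishes identically. The vectors with vanishing samples form a subspace that is
the sum of its intersections with generalised eigenspaces of `exp(h A)`, hence of `A`; on these the
output is an exponential times a polynomial with infinitely many zeros. -/
theorem outputSignal_eq_zero_of_periodic {d : ℕ} (A : Matrix (Fin d) (Fin d) ℂ) (c : Fin d → ℂ)
    {h : ℝ} (hh : 0 < h)
    (hpath : ∀ a b, Module.End.HasEigenvalue (Matrix.toLin' A) a →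
      Module.End.HasEigenvalue (Matrix.toLin' A) b → a ≠ b →
      ∀ k : ℤ, (h : ℂ) * (a - b) ≠ 2 * (k : ℂ) * (Real.pi : ℂ) * Complex.I)
    {w : Fin d → ℂ} (hw : ∀ k : ℕ, outputSignal A c w (k * h) = 0) (s : ℝ) :
    outputSignal A c w s = 0 := by
  set M := NormedSpace.exp (h • A) with hM
  let W : Submodule ℂ (Fin d → ℂ) :=
    { carrier := {w | ∀ k : ℕ, outputSignal A c w (k * h) = 0}
      add_mem' := fun {x y} hx hy k => by
        have h1 := hx k
        have h2 := hy k
        simp only [outputSignal, Matrix.mulVec_add, dotProduct_add] at h1 h2 ⊢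
        rw [h1, h2, add_zero]
      zero_mem' := fun k => by simp [outputSignal]
      smul_mem' := fun r x hx k => by
        have h1 := hx k
        simp only [outputSignal, Matrix.mulVec_smul, dotProduct_smul] at h1 ⊢
        rw [h1, smul_zero] }
  let U : Submodule ℂ (Fin d → ℂ) :=
    { carrier := {w | ∀ s : ℝ, outputSignal A c w s = 0}
      add_mem' := fun {x y} hx hy s => by
        have h1 := hx s
        have h2 := hy s
        simp only [outputSignal, Matrix.mulVec_add, dotProduct_add] at h1 h2 ⊢
        rw [h1, h2, add_zero]
      zero_mem' := fun s => by simp [outputSignal]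
      smul_mem' := fun r x hx s => by
        have h1 := hx s
        simp only [outputSignal, Matrix.mulVec_smul, dotProduct_smul] at h1 ⊢
        rw [h1, smul_zero] }
  have hWinv : ∀ x ∈ W, Matrix.toLin' M x ∈ W := by
    intro x hx k
    have := hx (k + 1)
    rwa [Nat.cast_succ, add_mul, one_mul, outputSignal_add] at this
  have hcomm : Commute (Matrix.toLin' M) (Matrix.toLin' A) := by
    have h1 : Commute M A := by
      let _ : NormedRing (Matrix (Fin d) (Fin d) ℂ) := Matrix.linftyOpNormedRing
      let _ : NormedAlgebra ℝ (Matrix (Fin d) (Fin d) ℂ) := Matrix.linftyOpNormedAlgebra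
      exact (((Commute.refl A).smul_left h).exp_left)
    exact h1.map Matrix.toLinAlgEquiv'
  have hle : W ≤ U := by
    rw [Submodule.eq_iSup_inf_genEigenspace ⊤ hWinv
      (Module.End.iSup_maxGenEigenspace_eq_top (Matrix.toLin' M))]
    refine iSup_le fun mu x hx => ?_
    obtain ⟨lam, hlam⟩ := exists_maxGenEigenspace_le hcomm (φ := fun lam => Complex.exp (h * lam))
      (fun w lam hw => exp_smul_mulVec_of_eigenvector A hw h)
      (fun a b ha hb hab => by
        by_contra hne
        obtain ⟨k, hk⟩ := Complex.exp_eq_exp_iff_exists_int.1 hab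
        refine hpath a b ha hb hne k ?_
        linear_combination hk) mu
    obtain ⟨k, hk⟩ := (Module.End.mem_maxGenEigenspace _ lam x).1 (hlam hx.2)
    have hk' : ((A - lam • (1 : Matrix (Fin d) (Fin d) ℂ)) ^ k).mulVec x = 0 := by
      have e : (Matrix.toLin' A - lam • 1) ^ k =
          Matrix.toLin' ((A - lam • (1 : Matrix (Fin d) (Fin d) ℂ)) ^ k) := by
        rw [Matrix.toLin'_pow, map_sub, map_smul, Matrix.toLin'_one]
        rfl
      rw [e] at hk
      exact hk
    obtain ⟨p, hp⟩ := exists_polynomial_outputSignal _ c hk'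
    have hroots : {z : ℂ | p.IsRoot z}.Infinite := by
      refine Set.infinite_of_injective_forall_mem (f := fun k : ℕ => (((k : ℝ) * h : ℝ) : ℂ)) ?_ ?_
      · intro k k' hkk
        have h1 : (k : ℝ) * h = k' * h := Complex.ofReal_injective hkk
        exact_mod_cast mul_right_cancel₀ hh.ne' h1
      · intro k
        change p.eval _ = 0
        rw [← hp, outputSignal_sub_scalar, hx.1 k, mul_zero]
    have hp0 := eq_zero_of_infinite_isRoot p hroots
    intro s
    have h1 := hp s
    rw [hp0, eval_zero, outputSignal_sub_scalar] at h1
    exact (mul_eq_zero.1 h1).resolve_left (Complex.exp_ne_zero _)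
  exact hle hw s

/-! ### Spectral data of a real matrix -/

open Filter Topology Polynomial

theorem mem_complexEigenvalues_iff {d : ℕ} (A : Matrix (Fin d) (Fin d) ℝ) (mu : ℂ) :
    mu ∈ complexEigenvalues A ↔
      Module.End.HasEigenvalue (Matrix.toLin' (complexified A)) mu := by
  rw [complexEigenvalues, Multiset.mem_toFinset, mem_roots (Matrix.charpoly_monic _).ne_zero,
    Module.End.hasEigenvalue_iff_isRoot_charpoly, Matrix.charpoly_toLin']

theorem conj_mem_complexEigenvalues {d : ℕ} {A : Matrix (Fin d) (Fin d) ℝ} {mu : ℂ}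
    (h : mu ∈ complexEigenvalues A) : (starRingEnd ℂ) mu ∈ complexEigenvalues A := by
  have e : (complexified A).charpoly = A.charpoly.map Complex.ofRealHom :=
    Matrix.charpoly_map A Complex.ofRealHom
  have hroot : ∀ x : ℂ, x ∈ complexEigenvalues A ↔ aeval x A.charpoly = 0 := by
    intro x
    rw [complexEigenvalues, Multiset.mem_toFinset, mem_roots (Matrix.charpoly_monic _).ne_zero, e,
      IsRoot.def, eval_map, aeval_def]
    rfl
  rw [hroot] at h ⊢
  rw [aeval_conj, h, map_zero]

theorem eigenvalueIndex_pos {d : ℕ} {A : Matrix (Fin d) (Fin d) ℝ} {mu : ℂ}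
    (h : mu ∈ complexEigenvalues A) : 0 < eigenvalueIndex A mu := by
  rw [Nat.pos_iff_ne_zero]
  intro h0
  obtain ⟨v, hv⟩ := ((mem_complexEigenvalues_iff A mu).1 h).exists_hasEigenvector
  have h1 := Module.End.eigenspace_le_maxGenEigenspace hv.1
  rw [Module.End.maxGenEigenspace_eq] at h1
  rw [eigenvalueIndex] at h0
  rw [h0, Nat.cast_zero, Module.End.genEigenspace_zero] at h1
  exact hv.2 h1

/-- The product of the powers `(X - μ) ^ 𝔪_μ`, with `𝔪_μ` the index of `μ`, annihilates `A`. -/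
theorem aeval_prod_eigenvalueIndex_mulVec {d : ℕ} (A : Matrix (Fin d) (Fin d) ℝ) (z : Fin d → ℂ) :
    (aeval (complexified A) (∏ mu ∈ complexEigenvalues A,
      (X - C mu) ^ eigenvalueIndex A mu)).mulVec z = 0 := by
  set B := complexified A with hB
  set q : ℂ[X] := ∏ mu ∈ complexEigenvalues A, (X - C mu) ^ eigenvalueIndex A mu with hq
  have htop : ⨆ mu, Module.End.maxGenEigenspace (Matrix.toLin' B) mu ≤
      (Matrix.toLin' (aeval B q)).ker := by
    refine iSup_le fun mu x hx => ?_
    rw [LinearMap.mem_ker, Matrix.toLin'_apply]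
    by_cases hmu : mu ∈ complexEigenvalues A
    · rw [Module.End.maxGenEigenspace_eq, Module.End.mem_genEigenspace_nat, LinearMap.mem_ker] at hx
      have e : (Matrix.toLin' B - mu • 1) ^ (eigenvalueIndex A mu) =
          Matrix.toLin' ((B - mu • (1 : Matrix (Fin d) (Fin d) ℂ)) ^ (eigenvalueIndex A mu)) := by
        rw [Matrix.toLin'_pow, map_sub, map_smul, Matrix.toLin'_one]
        rfl
      have hx' : ((B - mu • (1 : Matrix (Fin d) (Fin d) ℂ)) ^ eigenvalueIndex A mu).mulVec x = 0 := by
        rw [← Matrix.toLin'_apply, ← e]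
        exact hx
      rw [hq, ← Finset.mul_prod_erase _ _ hmu, mul_comm, map_mul, ← Matrix.mulVec_mulVec, map_pow,
        map_sub, aeval_X, aeval_C, Algebra.algebraMap_eq_smul_one, hx', Matrix.mulVec_zero]
    · have hbot : Module.End.maxGenEigenspace (Matrix.toLin' B) mu = ⊥ := by
        by_contra hne
        refine hmu ((mem_complexEigenvalues_iff A mu).2 ?_)
        exact Module.End.HasUnifEigenvalue.lt (m := 1) zero_lt_one (k := ⊤) hne
      rw [hbot, Submodule.mem_bot] at hx
      rw [hx, Matrix.mulVec_zero]
  rw [Module.End.iSup_maxGenEigenspace_eq_top] at htop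
  exact LinearMap.mem_ker.1 (htop (Submodule.mem_top (x := z)))

/-- The eigenvalues of `A`, each repeated as often as its index says, in the order of increasing
imaginary parts. -/
theorem exists_sorted_eigenvalue_list {d : ℕ} (A : Matrix (Fin d) (Fin d) ℝ) :
    ∃ L : List ℂ, L.Pairwise (fun x y => x.im ≤ y.im) ∧ L.length = sumEigenvalueIndices A ∧
      (∀ mu, mu ∈ L ↔ mu ∈ complexEigenvalues A) ∧
      (L.map fun mu => X - C mu).prod =
        ∏ mu ∈ complexEigenvalues A, (X - C mu) ^ eigenvalueIndex A mu := by
  set S : Multiset ℂ := ∑ mu ∈ complexEigenvalues A,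
    Multiset.replicate (eigenvalueIndex A mu) mu with hS
  let r : ℂ → ℂ → Prop := fun x y => x.im ≤ y.im
  have : Std.Total r := ⟨fun x y => le_total x.im y.im⟩
  have : IsTrans ℂ r := ⟨fun x y z => le_trans⟩
  classical
  have hperm := List.perm_insertionSort r S.toList
  refine ⟨S.toList.insertionSort r, List.pairwise_insertionSort r _, ?_, fun mu => ?_, ?_⟩
  · rw [hperm.length_eq, Multiset.length_toList, hS, Multiset.card_sum]
    simp [sumEigenvalueIndices]
  · rw [hperm.mem_iff, Multiset.mem_toList, hS, Multiset.mem_sum]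
    constructor
    · rintro ⟨nu, hnu, h⟩
      rwa [Multiset.eq_of_mem_replicate h]
    · intro h
      exact ⟨mu, h, Multiset.mem_replicate.2 ⟨(eigenvalueIndex_pos h).ne', rfl⟩⟩
  · rw [(hperm.map _).prod_eq, ← Multiset.prod_coe, ← Multiset.map_coe, Multiset.coe_toList, hS,
      ← Multiset.coe_mapAddMonoidHom, map_sum, Multiset.prod_sum]
    simp

theorem im_sub_le_spectralSpread {d : ℕ} {A : Matrix (Fin d) (Fin d) ℝ} {mu nu : ℂ}
    (hmu : mu ∈ complexEigenvalues A) (hnu : nu ∈ complexEigenvalues A) :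
    (nu - mu).im ≤ spectralSpread A := by
  refine le_csSup ?_ ⟨mu, hmu, nu, hnu, rfl⟩
  have hfin : {r : ℝ | ∃ mu ∈ complexEigenvalues A, ∃ nu ∈ complexEigenvalues A,
      r = (nu - mu).im} ⊆ ((complexEigenvalues A ×ˢ complexEigenvalues A).image
        fun p => (p.2 - p.1).im : Finset ℝ) := by
    rintro r ⟨mu, hmu, nu, hnu, rfl⟩
    exact Finset.mem_coe.2 (Finset.mem_image.2 ⟨(mu, nu), Finset.mem_product.2 ⟨hmu, hnu⟩, rfl⟩)
  exact (Finset.bddAbove _).mono hfin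

theorem spectralSpread_nonneg {d : ℕ} (A : Matrix (Fin d) (Fin d) ℝ) : 0 ≤ spectralSpread A := by
  rcases (complexEigenvalues A).eq_empty_or_nonempty with h | ⟨mu, hmu⟩
  · simp [spectralSpread, h]
  · simpa using im_sub_le_spectralSpread hmu hmu

theorem le_maxObservationLength {Nbar ℓ : ℕ} (t : ℕ → ℕ → ℝ) {i : ℕ}
    (hi : i ∈ Finset.Icc 1 Nbar) : t i ℓ - t i 1 ≤ maxObservationLength Nbar ℓ t := by
  refine le_csSup ?_ ⟨i, hi, rfl⟩
  have hfin : {r : ℝ | ∃ i ∈ Finset.Icc 1 Nbar, r = t i ℓ - t i 1} ⊆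
      ((Finset.Icc 1 Nbar).image fun i => t i ℓ - t i 1 : Finset ℝ) := by
    rintro r ⟨i, hi, rfl⟩
    exact Finset.mem_coe.2 (Finset.mem_image.2 ⟨i, hi, rfl⟩)
  exact (Finset.bddAbove _).mono hfin

/-! ### Real outputs -/

/-- The real output `s ↦ cᵀ exp(s A) z`. -/
noncomputable def realOutputSignal {d : ℕ} (A : Matrix (Fin d) (Fin d) ℝ) (c z : Fin d → ℝ)
    (s : ℝ) : ℝ :=
  c ⬝ᵥ (NormedSpace.exp (s • A)).mulVec z

theorem outputSignal_complexified {d : ℕ} (A : Matrix (Fin d) (Fin d) ℝ) (c z : Fin d → ℝ)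
    (s : ℝ) :
    outputSignal (complexified A) (fun j => (c j : ℂ)) (fun j => (z j : ℂ)) s =
      realOutputSignal A c z s := by
  have h1 : NormedSpace.exp (s • complexified A) = complexified (NormedSpace.exp (s • A)) := by
    let _ : NormedRing (Matrix (Fin d) (Fin d) ℝ) := Matrix.linftyOpNormedRing
    let _ : NormedAlgebra ℝ (Matrix (Fin d) (Fin d) ℝ) := Matrix.linftyOpNormedAlgebra
    let _ : NormedAlgebra ℚ (Matrix (Fin d) (Fin d) ℝ) := NormedAlgebra.restrictScalars ℚ ℝ _
    let _ : NormedRing (Matrix (Fin d) (Fin d) ℂ) := Matrix.linftyOpNormedRing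
    have hcont : Continuous (Complex.ofRealHom.mapMatrix : Matrix (Fin d) (Fin d) ℝ →+* _) := by
      exact continuous_id.matrix_map Complex.continuous_ofReal
    have h2 := NormedSpace.map_exp (Complex.ofRealHom.mapMatrix : Matrix (Fin d) (Fin d) ℝ →+* _)
      hcont (s • A)
    have h3 : (Complex.ofRealHom.mapMatrix (s • A) : Matrix (Fin d) (Fin d) ℂ) =
        s • complexified A := by
      ext i j
      simp [complexified]
    rw [h3] at h2
    exact h2.symm
  rw [outputSignal, h1, realOutputSignal]
  simp [dotProduct, Matrix.mulVec, complexified]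

/-- An output that vanishes at all sampling times of one trajectory vanishes identically, whichever
of the three sampling conditions holds. -/
theorem realOutputSignal_eq_zero_of_samples {d Nbar ℓ : ℕ} (A : Matrix (Fin d) (Fin d) ℝ) {T : ℝ}
    {t : ℕ → ℕ → ℝ} (hsched : IsSamplingSchedule Nbar ℓ T t)
    (hsamp : EquidistantSampling A Nbar ℓ t ∨ PeriodicSampling d Nbar ℓ t ∨
      IrregularSampling A Nbar ℓ t) {i : ℕ} (hi : i ∈ Finset.Icc 1 Nbar) (c z : Fin d → ℝ)
    (h0 : ∀ l ∈ Finset.Icc 1 ℓ, realOutputSignal A c z (t i l) = 0) (s : ℝ) :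
    realOutputSignal A c z s = 0 := by
  set B := complexified A
  set c' : Fin d → ℂ := fun j => (c j : ℂ)
  set z' : Fin d → ℂ := fun j => (z j : ℂ)
  have hreal : ∀ s, outputSignal B c' z' s = realOutputSignal A c z s :=
    outputSignal_complexified A c z
  have h0' : ∀ l ∈ Finset.Icc 1 ℓ, outputSignal B c' z' (t i l) = 0 := fun l hl => by
    rw [hreal, h0 l hl, Complex.ofReal_zero]
  rcases hsamp with ⟨Δ, hΔ, ht, hpath, hd⟩ | ⟨Δ, Δ', b, hΔ, hΔ', hirr, hb, hbd, ht⟩ | hirr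
  · set w := (NormedSpace.exp ((t i 1) • B)).mulVec z' with hw
    have h1 : ∀ k < d, c' ⬝ᵥ (NormedSpace.exp (Δ • B) ^ k).mulVec w = 0 := by
      intro k hk
      have hl : k + 1 ∈ Finset.Icc 1 ℓ := Finset.mem_Icc.2 ⟨by omega, by omega⟩
      have h2 := h0' _ hl
      rw [ht i hi _ hl, show t i 1 + (((k + 1 : ℕ) : ℝ) - 1) * Δ = k * Δ + t i 1 by push_cast; ring,
        outputSignal_add, outputSignal, exp_natCast_mul_smul_matrix] at h2
      exact h2
    have h2 : ∀ k : ℕ, outputSignal B c' w (k * Δ) = 0 := by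
      intro k
      have := dotProduct_aeval_mulVec_eq_zero h1 (X ^ k)
      rwa [map_pow, aeval_X, ← exp_natCast_mul_smul_matrix] at this
    have h3 := outputSignal_eq_zero_of_periodic B c' hΔ (fun x y hx hy hxy k =>
      hpath x ((mem_complexEigenvalues_iff A x).2 hx) y ((mem_complexEigenvalues_iff A y).2 hy)
        hxy k) h2 (s - t i 1)
    rw [hw, ← outputSignal_add, sub_add_cancel, hreal] at h3
    exact_mod_cast h3
  · set P := (b : ℝ) * Δ + Δ' with hP
    have hgrid : ∀ j < d, ∀ r ≤ b, t i (j * (b + 1) + r + 1) = t i 1 + j * P + r * Δ := by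
      intro j
      induction j with
      | zero =>
        intro hj r hr
        have hl : r + 1 ∈ Finset.Icc 1 ℓ := Finset.mem_Icc.2 ⟨by omega, by nlinarith⟩
        have := (ht i hi _ hl).1 (by omega)
        simp only [zero_mul, zero_add]
        rw [this]
        push_cast
        ring
      | succ j ih =>
        intro hj r hr
        have hle : (j + 1) * (b + 1) + r + 1 ≤ ℓ := by
          have : (j + 2) * (b + 1) ≤ d * (b + 1) := Nat.mul_le_mul_right _ hj
          nlinarith
        have hl : (j + 1) * (b + 1) + r + 1 ∈ Finset.Icc 1 ℓ := Finset.mem_Icc.2 ⟨by omega, hle⟩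
        have ht' := ht i hi _ hl
        by_cases hjr : j = 0 ∧ r = 0
        · obtain ⟨rfl, rfl⟩ := hjr
          rw [ht'.2.1 (by ring), hP]
          push_cast
          ring
        · have hge : b + 3 ≤ (j + 1) * (b + 1) + r + 1 := by
            rcases Nat.eq_zero_or_pos j with rfl | hj0
            · have : r ≠ 0 := fun h => hjr ⟨rfl, h⟩
              omega
            · nlinarith
          have hidx : (j + 1) * (b + 1) + r + 1 - (b + 1) = j * (b + 1) + r + 1 := by
            rw [Nat.sub_eq_iff_eq_add (by omega)]; ring
          rw [ht'.2.2 hge, hidx, ih (by omega) r hr, hP]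
          push_cast
          ring
    set w := (NormedSpace.exp ((t i 1) • B)).mulVec z' with hw
    have h1 : ∀ r < d, ∀ j < d, outputSignal B c' w (r * Δ + j * P) = 0 := by
      intro r hr j hj
      have hle : j * (b + 1) + r + 1 ≤ ℓ := by
        have : (j + 1) * (b + 1) ≤ d * (b + 1) := Nat.mul_le_mul_right _ hj
        nlinarith
      have h2 := h0' _ (Finset.mem_Icc.2 ⟨by omega, hle⟩)
      rwa [hgrid j hj r (by omega),
        show t i 1 + j * P + r * Δ = (r * Δ + j * P) + t i 1 by ring, outputSignal_add] at h2
    have h3 := outputSignal_eq_zero_of_doubly_periodic B c' hirr hP h1 (s - t i 1)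
    rw [hw, ← outputSignal_add, sub_add_cancel, hreal] at h3
    exact_mod_cast h3
  · by_contra hne
    obtain ⟨L, hL, hlen, hmem, hprod⟩ := exists_sorted_eigenvalue_list A
    set δ := spectralSpread A with hδ
    have hδ0 : 0 ≤ δ := spectralSpread_nonneg A
    -- conjugation symmetry of the spectrum bounds imaginary parts by half the spread
    have hM : ∀ mu ∈ L, mu.im ≤ δ / 2 := by
      intro mu hmu
      have h1 := (hmem mu).1 hmu
      have h2 := im_sub_le_spectralSpread (conj_mem_complexEigenvalues h1) h1
      rw [Complex.sub_im, Complex.conj_im] at h2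
      linarith
    have hneg : ∀ mu ∈ L.head?, mu.im ≤ 0 := by
      intro mu hmu
      obtain ⟨L', rfl⟩ : ∃ L', L = mu :: L' := by
        cases L with
        | nil => simp at hmu
        | cons x L' => exact ⟨L', by simpa using hmu⟩
      have h1 := (hmem _).2 (conj_mem_complexEigenvalues ((hmem mu).1 (by simp)))
      rcases List.mem_cons.1 h1 with h2 | h2
      · have := congrArg Complex.im h2
        rw [Complex.conj_im] at this
        linarith
      · have := (List.pairwise_cons.1 hL).1 _ h2
        rw [Complex.conj_im] at this
        linarith
    have hmono : ∀ l l' : ℕ, 1 ≤ l → l < l' → l' ≤ ℓ → t i l < t i l' :=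
      hsched.strict_increasing i hi
    have hle : ∀ l l' : ℕ, 1 ≤ l → l ≤ l' → l' ≤ ℓ → t i l ≤ t i l' := by
      intro l l' h1 h2 h3
      rcases h2.eq_or_lt with rfl | h2
      · exact le_rfl
      · exact (hmono l l' h1 h2 h3).le
    have hinj : Set.InjOn (t i) (Finset.Icc 1 ℓ : Finset ℕ) := by
      intro l hl l' hl' h
      rw [Finset.mem_coe, Finset.mem_Icc] at hl hl'
      rcases lt_trichotomy l l' with h1 | h1 | h1
      · exact absurd h (hmono l l' hl.1 h1 hl'.2).ne
      · exact h1
      · exact absurd h (hmono l' l hl'.1 h1 hl.2).ne'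
    have hτ0 : 0 ≤ t i ℓ - t i 1 := sub_nonneg.2 (hle 1 ℓ le_rfl hsched.one_le_ell le_rfl)
    have hcard := card_zeros_outputSignal_le B c' z' (α := t i 1) hτ0 (by positivity) hL hM
      hneg (by rw [hprod]; exact aeval_prod_eigenvalueIndex_mulVec A z') hreal ⟨s, hne⟩
      ((Finset.Icc 1 ℓ).image (t i)) (by
        intro x hx
        obtain ⟨l, hl, rfl⟩ := Finset.mem_image.1 hx
        have hl' := Finset.mem_Icc.1 hl
        refine ⟨⟨hle 1 l le_rfl hl'.1 hl'.2, ?_⟩, h0 l hl⟩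
        rw [add_sub_cancel]
        exact hle l ℓ hl'.1 hl'.2 le_rfl)
    rw [Finset.card_image_of_injOn hinj, Nat.card_Icc, Nat.add_sub_cancel, hlen] at hcard
    have hpi := Real.pi_pos
    have h1 : (t i ℓ - t i 1) * (δ / 2) / Real.pi ≤
        maxObservationLength Nbar ℓ t * δ / (2 * Real.pi) := by
      rw [show (t i ℓ - t i 1) * (δ / 2) / Real.pi = (t i ℓ - t i 1) * δ / (2 * Real.pi) by
        field_simp]
      gcongr
      exact le_maxObservationLength t hi
    have h2 : (ℓ : ℝ) > (sumEigenvalueIndices A : ℝ) - 1 +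
      maxObservationLength Nbar ℓ t * δ / (2 * Real.pi) := hirr
    linarith

theorem isLeftInvertibleMatrix_of_ker {ρ : Type*} [Fintype ρ] {d : ℕ} (M : Matrix ρ (Fin d) ℝ)
    (h : ∀ x, M.mulVec x = 0 → x = 0) : IsLeftInvertibleMatrix M := by
  classical
  obtain ⟨g, hg⟩ := LinearMap.exists_leftInverse_of_injective (Matrix.toLin' M)
    (LinearMap.ker_eq_bot'.2 fun x hx => h x hx)
  refine ⟨LinearMap.toMatrix' g, ?_⟩
  have := congrArg LinearMap.toMatrix' hg
  rwa [LinearMap.toMatrix'_comp, LinearMap.toMatrix'_toLin', LinearMap.toMatrix'_id] at this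

theorem mainTheorem9 {d m Nbar ℓ : ℕ} (A : Matrix (Fin d) (Fin d) ℝ)
    (C : Matrix (Fin m) (Fin d) ℝ) (T : ℝ) (t : ℕ → ℕ → ℝ)
    (hsched : IsSamplingSchedule Nbar ℓ T t)
    (hobs : IsObservablePair A C)
    (hsamp : EquidistantSampling A Nbar ℓ t ∨ PeriodicSampling d Nbar ℓ t ∨
      IrregularSampling A Nbar ℓ t) :
    ∀ i ∈ Finset.Icc 1 Nbar, IsLeftInvertibleMatrix
      (sampleObservabilityMatrix (fun _ => C) (ltiFundamentalMatrix A) ℓ (t i)) := by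
  intro i hi
  refine isLeftInvertibleMatrix_of_ker _ fun x hx => ?_
  -- `z` is the state at time `0` of the trajectory that is at `x` at the last sampling time
  set z := (NormedSpace.exp ((-t i ℓ) • A)).mulVec x with hz
  have hzero : ∀ p : Fin m, ∀ s, realOutputSignal A (C p) z s = 0 := by
    intro p
    refine realOutputSignal_eq_zero_of_samples A hsched hsamp hi (C p) z fun l hl => ?_
    have hl' := Finset.mem_Icc.1 hl
    have h1 := congrFun hx (⟨l - 1, by omega⟩, p)
    have hl1 : l - 1 + 1 = l := by omega
    rw [realOutputSignal, hz, Matrix.mulVec_mulVec, ← exp_add_smul_matrix, ← sub_eq_add_neg]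
    have h2 : (C * ltiFundamentalMatrix A (t i l) (t i ℓ)).mulVec x p = 0 := by
      simpa [sampleObservabilityMatrix, Matrix.mulVec, dotProduct, hl1] using h1
    rw [← Matrix.mulVec_mulVec] at h2
    exact h2
  have hz0 : z = 0 := by
    refine hobs z 0 fun s _ => ?_
    rw [Matrix.mulVec_zero, Matrix.mulVec_zero]
    funext p
    have := hzero p s
    rw [realOutputSignal] at this
    rw [ltiFundamentalMatrix, sub_zero]
    exact this
  have hback : (NormedSpace.exp ((t i ℓ) • A)).mulVec z = x := by
    rw [hz, Matrix.mulVec_mulVec, ← exp_add_smul_matrix, add_neg_cancel, zero_smul, NormedSpace.exp_zero,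
      Matrix.one_mulVec]
  rw [← hback, hz0, Matrix.mulVec_zero]
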